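/- Let $F$ be a non-archimedean local field with ring of integers $\mathcal O$, maximal ideal $\mathfrak M=\varpi\mathcal O$, and residue field of cardinality $q$ and characteristic $p\neq 2$. Let $E/F$ be the unramified quadratic extension, $\sigma$ its nontrivial automorphism, and $\mathcal O^E$ its ring of integers. Let $r=2l$ with $l\ge 1$, and put $\mathcal O_r=\mathcal O/\varpi^r\mathcal O$, $\mathcal O_r^E=\mathcal O^E/\varpi^r\mathcal O^E$, $\mathrm{Tr}(z)=z+\sigma(z)$ and $N(z)=z\sigma(z)$ for $z\in\mathcal O_r^E$ (both with values in $\mathcal O_r$), $G=GL(2,\mathcal O_r)$ and $K_l=\{g\in G: g\equiv I \bmod \varpi^l\}$. Fix an additive character $\psi:\mathcal O_r\to\mathbb C^\times$ that is nontrivial on $\varpi^{r-1}\mathcal O_r$. Let $(\nu,\nu')$ be a regular pair of characters of $(\mathcal O_r^E)^\times$, i.e. $\nu\nu'^{-1}$ is nontrivial on $\{1+\varpi^{r-1}z : z\in\mathcal O_r^E,\ \sigma(z)=-z\}$. Then there is $\tau\in\mathcal O_r^E$ with $\tau\not\equiv\sigma(\tau) \bmod \varpi$ and $$\nu(1+\varpi^l(x+y\tau))\,\nu'(1+\varpi^l(x+y\sigma(\tau)))=\psi\big(\varpi^l\,\mathrm{Tr}(\tau(x+y\tau))\big)\qquad\text{for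 all }x,y\in\mathcal O_r. \tag{$*$}$$ For any such $\tau$ put $\beta_\tau=\begin{pmatrix}0&1\\-N(\tau)&\mathrm{Tr}(\tau)\end{pmatrix}$, $S=\mathcal O_r[\beta_\tau]^\times$ and $T=SK_l$. Let $\nu\boxtimes\nu'$ be the character of $T$ given by $$(\nu\boxtimes\nu')(sk)=\nu(a+b\tau)\,\nu'(a+b\sigma(\tau))\,\psi\big(\mathrm{tr}(\beta_\tau(k-I))\big)$$ for $s=aI+b\beta_\tau\in S$ and $k\in K_l$ (well defined by $(*)$), and let $\mathcal C_{\nu,\nu'}=\mathrm{Ind}_T^G(\nu\boxtimes\nu')$ be the cuspidal representation attached to $(\nu,\nu')$. Let $\epsilon\in\mathcal O_r^\times$ be a non-square and $\Phi\in\mathcal O_r^E$ with $\Phi^2=\epsilon$. Then for all $i\in\{0,\dots,r-1\}$, $\alpha\in\mathcal O_r$ and $\beta\in\mathcal O_r^\times$ with $\alpha^2-\epsilon\beta^2\varpi^{2i}\in\mathcal O_r^\times$, the elliptic element $$C_{i,\alpha,\beta}=\begin{pmatrix}\alpha&\varpi^i\epsilon\beta\\ \varpi^i\beta&\alpha\end{pmatrix}\in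 G$$ satisfies $$\mathrm{tr}\big(C_{i,\alpha,\beta}\,\big|\,\mathcal C_{\nu,\nu'}\big)=(-q)^i\Big(\nu(\alpha+\varpi^i\Phi\beta)\,\nu'(\alpha-\varpi^i\Phi\beta)+\nu(\alpha-\varpi^i\Phi\beta)\,\nu'(\alpha+\varpi^i\Phi\beta)\Big).$$ -/

import Mathlib

open scoped ValuativeRel

namespace CuspidalGL2

/-! ### Gluing a character of a subgroup with a character of a normal subgroup -/

section Glue

variable {G A : Type*} [Group G] [CommGroup A] (S K : Subgroup G)
  (f : S →* A) (g : K →* A)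

theorem glue_unique
    (hagree : ∀ (x : G) (hs : x ∈ S) (hk : x ∈ K), f ⟨x, hs⟩ = g ⟨x, hk⟩)
    (s s' : S) (k k' : K) (h : (s : G) * k = s' * k') : f s * g k = f s' * g k' := by
  have h1 : (s' : G)⁻¹ * s = k' * (k : G)⁻¹ := by
    rw [inv_mul_eq_iff_eq_mul, ← mul_assoc, ← h]; group
  have h2 : (s' : G)⁻¹ * s ∈ K := by
    rw [h1]; exact K.mul_mem k'.2 (K.inv_mem k.2)
  have h3 := hagree ((s' : G)⁻¹ * s) (S.mul_mem (S.inv_mem s'.2) s.2) h2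
  have e1 : (⟨(s' : G)⁻¹ * s, S.mul_mem (S.inv_mem s'.2) s.2⟩ : S) = s'⁻¹ * s := rfl
  have e2 : (⟨(s' : G)⁻¹ * s, h2⟩ : K) = k' * k⁻¹ := Subtype.ext h1
  rw [e1, e2, map_mul, map_mul, map_inv, map_inv, inv_mul_eq_iff_eq_mul] at h3
  rw [h3]
  simp [mul_assoc]

variable [K.Normal]

theorem exists_glue (x : ↥(S ⊔ K)) : ∃ p : S × K, (p.1 : G) * p.2 = x := by
  obtain ⟨y, hy, z, hz, h⟩ := Subgroup.mem_sup_of_normal_right.1 x.2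
  exact ⟨(⟨y, hy⟩, ⟨z, hz⟩), h⟩

/-- If the characters `f` of `S` and `g` of the normal subgroup `K` agree on `S ∩ K` and `g` is
invariant under conjugation by `S`, this is the character `s k ↦ f(s) g(k)` of `S K`. -/
noncomputable def glue
    (hagree : ∀ (x : G) (hs : x ∈ S) (hk : x ∈ K), f ⟨x, hs⟩ = g ⟨x, hk⟩)
    (hconj : ∀ (s : S) (k k' : K), (k' : G) = s * k * (s : G)⁻¹ → g k' = g k) :
    ↥(S ⊔ K) →* A :=
  MonoidHom.mk'
    (fun x => f (exists_glue S K x).choose.1 * g (exists_glue S K x).choose.2) (by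
      intro x y
      have hx := (exists_glue S K x).choose_spec
      have hy := (exists_glue S K y).choose_spec
      have hxy := (exists_glue S K (x * y)).choose_spec
      generalize (exists_glue S K x).choose = p at hx ⊢
      generalize (exists_glue S K y).choose = q at hy ⊢
      generalize (exists_glue S K (x * y)).choose = u at hxy ⊢
      obtain ⟨s, k⟩ := p
      obtain ⟨s', k'⟩ := q
      obtain ⟨s'', k''⟩ := u
      let c : K := ⟨(s' : G)⁻¹ * k * s', by
        simpa using Subgroup.Normal.conj_mem (n := (k : G)) inferInstance k.2 (s' : G)⁻¹⟩
      have hc : g k = g c := hconj s' c k (by simp [c, mul_assoc])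
      have h := glue_unique S K f g hagree s'' (s * s') k'' (c * k') (by
        have : ((x * y : ↥(S ⊔ K)) : G) = x * y := rfl
        simp only at hx hy hxy
        rw [hxy, this, ← hx, ← hy]
        simp [c, mul_assoc])
      simp only at h ⊢
      rw [h, map_mul, map_mul, hc]
      exact mul_mul_mul_comm _ _ _ _)

theorem glue_mul
    (hagree : ∀ (x : G) (hs : x ∈ S) (hk : x ∈ K), f ⟨x, hs⟩ = g ⟨x, hk⟩)
    (hconj : ∀ (s : S) (k k' : K), (k' : G) = s * k * (s : G)⁻¹ → g k' = g k)
    (x : ↥(S ⊔ K)) (s : S) (k : K) (h : (s : G) * k = x) :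
    glue S K f g hagree hconj x = f s * g k :=
  glue_unique S K f g hagree _ s _ k ((exists_glue S K x).choose_spec.trans h.symm)

end Glue

/-! ### The inertia subgroup and its characters, over a commutative ring -/

section Ring

variable {R : Type*} [CommRing R]

/-- The companion matrix of `X² - t X + n`. -/
def compMatrix (n t : R) : Matrix (Fin 2) (Fin 2) R := !![0, 1; -n, t]

theorem compMatrix_sq (n t : R) :
    compMatrix n t * compMatrix n t = t • compMatrix n t - n • 1 := by
  ext i j
  fin_cases i <;> fin_cases j <;>
    simp [compMatrix, Matrix.mul_apply, Fin.sum_univ_two]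
  ring

theorem lin_mul_lin (n t a b c d : R) :
    (a • (1 : Matrix (Fin 2) (Fin 2) R) + b • compMatrix n t) * (c • 1 + d • compMatrix n t)
      = (a * c - b * d * n) • (1 : Matrix (Fin 2) (Fin 2) R)
        + (a * d + b * c + b * d * t) • compMatrix n t := by
  ext i j
  fin_cases i <;> fin_cases j <;>
    simp [compMatrix, Matrix.mul_apply, Fin.sum_univ_two, Matrix.one_apply] <;> ring

/-- `S = R[β]ˣ`, the invertible matrices of the form `a + b β`, where `β` is the companion matrix
of `X² - t X + n`. -/
def torus (n t : R) : Subgroup (GL (Fin 2) R) where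
  carrier := {g | ∃ a b : R,
    (g : Matrix (Fin 2) (Fin 2) R) = a • (1 : Matrix (Fin 2) (Fin 2) R) + b • compMatrix n t}
  mul_mem' := by
    rintro g h ⟨a, b, hg⟩ ⟨c, d, hh⟩
    exact ⟨_, _, by rw [Units.val_mul, hg, hh, lin_mul_lin]⟩
  one_mem' := ⟨1, 0, by simp⟩
  inv_mem' := by
    rintro g ⟨a, b, hg⟩
    obtain ⟨u, hu⟩ : IsUnit (a * (a + b * t) + b * b * n) := by
      have h := (Matrix.isUnit_iff_isUnit_det _).1 g.isUnit
      rw [hg] at h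
      convert h using 1
      simp [compMatrix, Matrix.det_fin_two]
      ring
    refine ⟨(↑u⁻¹ : R) * (a + b * t), -((↑u⁻¹ : R) * b), ?_⟩
    have h1 : (g : Matrix (Fin 2) (Fin 2) R) * (((↑u⁻¹ : R) * (a + b * t)) •
        (1 : Matrix (Fin 2) (Fin 2) R) + (-((↑u⁻¹ : R) * b)) • compMatrix n t) = 1 := by
      rw [hg, lin_mul_lin]
      have e1 : a * ((↑u⁻¹ : R) * (a + b * t)) - b * (-((↑u⁻¹ : R) * b)) * n = 1 := by
        rw [← u.inv_mul, hu]; ring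
      have e2 : a * (-((↑u⁻¹ : R) * b)) + b * ((↑u⁻¹ : R) * (a + b * t))
          + b * (-((↑u⁻¹ : R) * b)) * t = 0 := by ring
      rw [e1, e2]; simp
    exact Units.inv_eq_of_mul_eq_one_right h1

theorem torus_eq {n t : R} (g : torus n t) :
    ((g : GL (Fin 2) R) : Matrix (Fin 2) (Fin 2) R) =
      ((g : GL (Fin 2) R) 0 0) • (1 : Matrix (Fin 2) (Fin 2) R)
        + ((g : GL (Fin 2) R) 0 1) • compMatrix n t := by
  obtain ⟨a, b, h⟩ := g.2
  rw [h]
  simp [compMatrix]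

/-- `K_l`, the matrices congruent to the identity modulo `ϖ^l`. -/
def congSubgroup (ϖ : R) (l : ℕ) : Subgroup (GL (Fin 2) R) :=
  (Matrix.GeneralLinearGroup.map (n := Fin 2)
    (Ideal.Quotient.mk (Ideal.span {ϖ ^ l}))).ker

instance (ϖ : R) (l : ℕ) : (congSubgroup ϖ l).Normal :=
  inferInstanceAs (MonoidHom.ker _).Normal

theorem exists_of_mem_congSubgroup {ϖ : R} {l : ℕ} {g : GL (Fin 2) R}
    (hg : g ∈ congSubgroup ϖ l) :
    ∃ X : Matrix (Fin 2) (Fin 2) R, (g : Matrix (Fin 2) (Fin 2) R) - 1 = ϖ ^ l • X := by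
  have key : ∀ i j : Fin 2, ∃ x : R,
      ((g : Matrix (Fin 2) (Fin 2) R) - 1) i j = ϖ ^ l * x := by
    intro i j
    have h := congrArg (fun u : GL (Fin 2) (R ⧸ Ideal.span {ϖ ^ l}) =>
      (u : Matrix (Fin 2) (Fin 2) (R ⧸ Ideal.span {ϖ ^ l})) i j) (MonoidHom.mem_ker.1 hg)
    have h2 : Ideal.Quotient.mk (Ideal.span {ϖ ^ l})
        (((g : Matrix (Fin 2) (Fin 2) R) - 1) i j) = 0 := by
      simp only [Matrix.GeneralLinearGroup.map_apply, Units.val_one] at h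
      rw [Matrix.sub_apply, map_sub, h, Matrix.one_apply, Matrix.one_apply]
      split_ifs <;> simp
    exact Ideal.mem_span_singleton.1 (Ideal.Quotient.eq_zero_iff_mem.1 h2)
  choose x hx using key
  exact ⟨Matrix.of x, by ext i j; simpa using hx i j⟩

/-- The inertia subgroup `T = S K_l`. -/
abbrev inertia (n t ϖ : R) (l : ℕ) : Subgroup (GL (Fin 2) R) :=
  torus n t ⊔ congSubgroup ϖ l

/-- The character `ψ_β : g ↦ ψ(tr(β (g - 1)))` of `K_l`, when `ϖ^{2l} = 0`. -/
noncomputable def psiChar (ψ : AddChar R ℂ) (M : Matrix (Fin 2) (Fin 2) R) (ϖ : R) (l : ℕ)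
    (hϖ : ϖ ^ l * ϖ ^ l = 0) : congSubgroup ϖ l →* ℂˣ :=
  MonoidHom.toHomUnits
    { toFun := fun g => ψ (M * (((g : GL (Fin 2) R) : Matrix (Fin 2) (Fin 2) R) - 1)).trace
      map_one' := by simp
      map_mul' := by
        intro g h
        obtain ⟨X, hX⟩ := exists_of_mem_congSubgroup g.2
        obtain ⟨Y, hY⟩ := exists_of_mem_congSubgroup h.2
        rw [← AddChar.map_add_eq_mul, ← Matrix.trace_add, ← mul_add]
        congr 3
        have h0 : (((g : GL (Fin 2) R) : Matrix (Fin 2) (Fin 2) R) - 1)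
            * (((h : GL (Fin 2) R) : Matrix (Fin 2) (Fin 2) R) - 1) = 0 := by
          rw [hX, hY, smul_mul_smul_comm, hϖ, zero_smul]
        rw [Subgroup.coe_mul, Units.val_mul]
        rw [sub_mul, mul_sub, one_mul, mul_one] at h0
        rw [← sub_eq_zero]
        rw [← h0]
        abel }

variable {B : Type*} [CommRing B] [Algebra R B]

/-- The ring homomorphism `a + b β ↦ a + b τ`, restricted to `S = R[β]ˣ`, where `τ` is a root of
`X² - t X + n`. -/
noncomputable def evalTorus (n t : R) (τ : B)
    (hτ : τ * τ = algebraMap R B t * τ - algebraMap R B n) : torus n t →* B where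
  toFun g := algebraMap R B ((g : GL (Fin 2) R) 0 0) + algebraMap R B ((g : GL (Fin 2) R) 0 1) * τ
  map_one' := by simp
  map_mul' := by
    intro g h
    have e : (((g * h : torus n t) : GL (Fin 2) R) : Matrix (Fin 2) (Fin 2) R) =
        ((g : GL (Fin 2) R) : Matrix (Fin 2) (Fin 2) R) * (h : GL (Fin 2) R) := rfl
    rw [torus_eq g, torus_eq h, lin_mul_lin] at e
    rw [e]
    simp only [compMatrix, Matrix.add_apply, Matrix.smul_apply, Matrix.one_apply, Matrix.of_apply,
      Matrix.cons_val', Matrix.cons_val_zero, Matrix.cons_val_one, smul_eq_mul, map_add, map_mul,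
      map_sub, mul_zero, mul_one, add_zero, if_true, Fin.isValue, zero_ne_one, if_false, zero_add]
    linear_combination (-(algebraMap R B ((g : GL (Fin 2) R) 0 1))
      * algebraMap R B ((h : GL (Fin 2) R) 0 1)) * hτ

/-- The character `θ_{ν,ν'} : a + b β ↦ ν(a + b τ) ν'(a + b τ')` of `S = R[β]ˣ`, where `τ, τ'` are
roots of `X² - t X + n`. -/
noncomputable def thetaChar (n t : R) (τ τ' : B)
    (hτ : τ * τ = algebraMap R B t * τ - algebraMap R B n)
    (hτ' : τ' * τ' = algebraMap R B t * τ' - algebraMap R B n)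
    (ν ν' : MulChar B ℂ) : torus n t →* ℂˣ :=
  MonoidHom.toHomUnits
    ((ν.toMonoidHom.comp (evalTorus n t τ hτ)) * (ν'.toMonoidHom.comp (evalTorus n t τ' hτ')))

/-- The character `ν ⊠ ν' = θ_{ν,ν'} ψ_β` of `T = S K_l`, given by `s k ↦ θ_{ν,ν'}(s) ψ_β(k)`. -/
noncomputable def boxChar (n t : R) (τ τ' : B)
    (hτ : τ * τ = algebraMap R B t * τ - algebraMap R B n)
    (hτ' : τ' * τ' = algebraMap R B t * τ' - algebraMap R B n)
    (ν ν' : MulChar B ℂ) (ψ : AddChar R ℂ) (ϖ : R) (l : ℕ) (hϖ : ϖ ^ l * ϖ ^ l = 0)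
    (hcomp : ∀ x y : R,
      ν (1 + algebraMap R B (ϖ ^ l) * (algebraMap R B x + algebraMap R B y * τ))
        * ν' (1 + algebraMap R B (ϖ ^ l) * (algebraMap R B x + algebraMap R B y * τ'))
      = ψ (ϖ ^ l * (x * t + y * (t * t - 2 * n)))) :
    ↥(inertia n t ϖ l) →* ℂˣ :=
  glue (torus n t) (congSubgroup ϖ l) (thetaChar n t τ τ' hτ hτ' ν ν')
    (psiChar ψ (compMatrix n t) ϖ l hϖ)
    (by
      intro x hs hk
      obtain ⟨X, hX⟩ := exists_of_mem_congSubgroup hk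
      have hx := torus_eq ⟨x, hs⟩
      simp only at hx
      have ha : x 0 0 = 1 + ϖ ^ l * X 0 0 := by
        have := congrFun (congrFun hX 0) 0
        simp at this
        linear_combination this
      have hb : x 0 1 = ϖ ^ l * X 0 1 := by
        have := congrFun (congrFun hX 0) 1
        simpa using this
      apply Units.ext
      change ν (algebraMap R B (x 0 0) + algebraMap R B (x 0 1) * τ)
        * ν' (algebraMap R B (x 0 0) + algebraMap R B (x 0 1) * τ')
        = ψ (compMatrix n t * ((x : Matrix (Fin 2) (Fin 2) R) - 1)).trace
      have e1 : ∀ ρ : B, algebraMap R B (x 0 0) + algebraMap R B (x 0 1) * ρ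
          = 1 + algebraMap R B (ϖ ^ l) *
            (algebraMap R B (X 0 0) + algebraMap R B (X 0 1) * ρ) := by
        intro ρ
        rw [ha, hb]
        simp only [map_add, map_mul, map_one]
        ring
      have e2 : (compMatrix n t * ((x : Matrix (Fin 2) (Fin 2) R) - 1)).trace
          = ϖ ^ l * (X 0 0 * t + X 0 1 * (t * t - 2 * n)) := by
        have e3 : (x : Matrix (Fin 2) (Fin 2) R) - 1
            = (ϖ ^ l * X 0 0) • (1 : Matrix (Fin 2) (Fin 2) R)
              + (ϖ ^ l * X 0 1) • compMatrix n t := by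
          rw [hx, ha, hb, add_smul, one_smul]
          abel
        rw [e3, mul_add, mul_smul_comm, mul_smul_comm, compMatrix_sq, mul_one, Matrix.trace_add,
          Matrix.trace_smul, Matrix.trace_smul, Matrix.trace_sub, Matrix.trace_smul,
          Matrix.trace_smul, Matrix.trace_one]
        simp [compMatrix, Matrix.trace_fin_two]
        ring
      rw [e1, e1, e2]
      exact hcomp _ _)
    (by
      intro s k k' h
      apply Units.ext
      change ψ (compMatrix n t * (((k' : GL (Fin 2) R) : Matrix (Fin 2) (Fin 2) R) - 1)).trace
        = ψ (compMatrix n t * (((k : GL (Fin 2) R) : Matrix (Fin 2) (Fin 2) R) - 1)).trace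
      have hc : compMatrix n t * ((s : GL (Fin 2) R) : Matrix (Fin 2) (Fin 2) R)
          = ((s : GL (Fin 2) R) : Matrix (Fin 2) (Fin 2) R) * compMatrix n t := by
        rw [torus_eq s]; simp [mul_add, add_mul]
      have hi : ((s : GL (Fin 2) R) : Matrix (Fin 2) (Fin 2) R)
          * (((s : GL (Fin 2) R)⁻¹ : GL (Fin 2) R) : Matrix (Fin 2) (Fin 2) R) = 1 := by
        rw [← Units.val_mul]; simp
      have hi' : (((s : GL (Fin 2) R)⁻¹ : GL (Fin 2) R) : Matrix (Fin 2) (Fin 2) R)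
          * ((s : GL (Fin 2) R) : Matrix (Fin 2) (Fin 2) R) = 1 := by
        rw [← Units.val_mul]; simp
      have e : ((k' : GL (Fin 2) R) : Matrix (Fin 2) (Fin 2) R) - 1 =
          ((s : GL (Fin 2) R) : Matrix (Fin 2) (Fin 2) R)
          * (((k : GL (Fin 2) R) : Matrix (Fin 2) (Fin 2) R) - 1)
          * (((s : GL (Fin 2) R)⁻¹ : GL (Fin 2) R) : Matrix (Fin 2) (Fin 2) R) := by
        rw [h, Units.val_mul, Units.val_mul, mul_sub, sub_mul, mul_one, hi]
      rw [e, ← mul_assoc, ← mul_assoc, hc, Matrix.trace_mul_comm, ← mul_assoc, ← mul_assoc, hi',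
        one_mul])

/-- The elliptic element with rows `(α, ϖ^i ε β)` and `(ϖ^i β, α)`. -/
noncomputable def ellipticElt (ϖ ε : R) (i : ℕ) (α β : R) (h : IsUnit (α ^ 2 - ε * β ^ 2 * ϖ ^ (2 * i))) :
    GL (Fin 2) R :=
  Matrix.GeneralLinearGroup.mk'' !![α, ϖ ^ i * ε * β; ϖ ^ i * β, α] (by
    have e : (!![α, ϖ ^ i * ε * β; ϖ ^ i * β, α] : Matrix (Fin 2) (Fin 2) R).det
        = α ^ 2 - ε * β ^ 2 * ϖ ^ (2 * i) := by
      rw [Matrix.det_fin_two_of]; ring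
    rw [e]; exact h)

end Ring

/-- A character of `H` with values in `ℂˣ`, as a one-dimensional representation. -/
noncomputable def oneDim {H : Type*} [Group H] (χ : H →* ℂˣ) : Representation ℂ H ℂ :=
  ((algebraMap ℂ (Module.End ℂ ℂ)).toMonoidHom.comp (Units.coeHom ℂ)).comp χ

/-! ### Unramified quadratic extensions of local fields -/

section Local

variable (F : Type*) [Field F] [ValuativeRel F] [TopologicalSpace F]
  [IsNonarchimedeanLocalField F] (E : Type*) [Field E] [Algebra F E]

/-- The ring of integers of `E`. -/
abbrev intE := ↥(integralClosure 𝒪[F] E)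

/-- `E` is an unramified quadratic extension of `F` (the maximal ideal of `F` generates a maximal
ideal of the ring of integers of `E`), with nontrivial automorphism `σ`. -/
structure IsUnramifiedQuadratic (σ : E ≃ₐ[F] E) : Prop where
  finrank_eq_two : Module.finrank F E = 2
  isMaximal : (𝓂[F].map (algebraMap 𝒪[F] (intE F E))).IsMaximal
  ne_one : σ ≠ 1

/-- `𝒪_r`, the ring of integers of `F` modulo the `r`-th power of the maximal ideal. -/
abbrev intMod (r : ℕ) := 𝒪[F] ⧸ 𝓂[F] ^ r

/-- `𝒪_r^E`, the ring of integers of `E` modulo the `r`-th power of the maximal ideal of `F`. -/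
abbrev intModE (r : ℕ) := intE F E ⧸ (𝓂[F] ^ r).map (algebraMap 𝒪[F] (intE F E))

variable {F E}

/-- The action of `σ` on the ring of integers of `E`. -/
noncomputable def sigmaInt (σ : E ≃ₐ[F] E) : intE F E ≃ₐ[𝒪[F]] intE F E :=
  (σ.restrictScalars 𝒪[F]).mapIntegralClosure

/-- The action of `σ` on `𝒪_r^E`. -/
noncomputable def sigmaMod (σ : E ≃ₐ[F] E) (r : ℕ) : intModE F E r →+* intModE F E r :=
  Ideal.quotientMap _ (sigmaInt σ : intE F E →+* intE F E) (by
    rw [Ideal.map_le_iff_le_comap]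
    intro x hx
    rw [Ideal.mem_comap, Ideal.mem_comap]
    have : (sigmaInt σ : intE F E →+* intE F E) (algebraMap 𝒪[F] (intE F E) x)
        = algebraMap 𝒪[F] (intE F E) x := (sigmaInt σ).commutes x
    rw [this]
    exact Ideal.mem_map_of_mem _ hx)

theorem sigmaInt_apply (σ : E ≃ₐ[F] E) (x : intE F E) : ((sigmaInt σ x : intE F E) : E) = σ x := rfl

theorem sigmaMod_mk (σ : E ≃ₐ[F] E) (r : ℕ) (x : intE F E) :
    sigmaMod σ r (Ideal.Quotient.mk _ x) = Ideal.Quotient.mk _ (sigmaInt σ x) := rfl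

theorem sigma_sigma {σ : E ≃ₐ[F] E} (h : IsUnramifiedQuadratic F E σ) (x : E) :
    σ (σ x) = x := by
  have : FiniteDimensional F E := Module.finite_of_finrank_eq_succ h.finrank_eq_two
  have hc : Nat.card (E ≃ₐ[F] E) ≤ 2 := by
    rw [← h.finrank_eq_two, Nat.card_eq_fintype_card]
    exact AlgEquiv.card_le
  have h1 : orderOf σ ≤ 2 := orderOf_le_card.trans hc
  have h2 : orderOf σ ≠ 1 := fun e => h.ne_one (orderOf_eq_one_iff.1 e)
  have h3 : 0 < orderOf σ := orderOf_pos σ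
  have h4 : orderOf σ = 2 := by omega
  have h5 : σ ^ 2 = 1 := h4 ▸ pow_orderOf_eq_one σ
  have h6 := DFunLike.congr_fun h5 x
  rwa [pow_two] at h6

theorem mem_range_of_fixed {σ : E ≃ₐ[F] E} (h : IsUnramifiedQuadratic F E σ) (x : E)
    (hx : σ x = x) : ∃ a : F, algebraMap F E a = x := by
  have : FiniteDimensional F E := Module.finite_of_finrank_eq_succ h.finrank_eq_two
  let L : IntermediateField F E := IntermediateField.fixedField (Subgroup.zpowers σ)
  have hL : x ∈ L := by
    rintro ⟨g, hg⟩
    have hg' : g ∈ MulAction.stabilizer (E ≃ₐ[F] E) x :=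
      (Subgroup.zpowers_le.2 (show σ ∈ MulAction.stabilizer (E ≃ₐ[F] E) x from hx)) hg
    exact hg'
  have h1 : Module.finrank F L * Module.finrank L E = 2 := by
    rw [Module.finrank_mul_finrank, h.finrank_eq_two]
  have h2 : Module.finrank L E ≠ 1 := by
    intro h3
    have h4 : L = ⊤ := IntermediateField.finrank_eq_one_iff_eq_top.1 h3
    apply h.ne_one
    ext y
    have hy : y ∈ L := h4 ▸ IntermediateField.mem_top
    exact hy ⟨σ, Subgroup.mem_zpowers σ⟩
  have h3 : Module.finrank F L = 1 := by
    have h4 : Module.finrank F L ∣ 2 := Dvd.intro _ h1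
    rcases (Nat.dvd_prime Nat.prime_two).1 h4 with h5 | h5
    · exact h5
    · rw [h5] at h1; omega
  have h4 : L = ⊥ := IntermediateField.finrank_eq_one_iff.1 h3
  rw [h4] at hL
  exact IntermediateField.mem_bot.1 hL

theorem exists_of_isIntegral (x : intE F E) (a : F) (hx : algebraMap F E a = x) :
    ∃ b : 𝒪[F], algebraMap 𝒪[F] (intE F E) b = x := by
  have h1 : IsIntegral 𝒪[F] (algebraMap F E a) := hx ▸ x.2
  have h2 : IsIntegral 𝒪[F] a :=
    (isIntegral_algebraMap_iff (algebraMap F E).injective).1 h1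
  obtain ⟨b, hb⟩ := IsIntegrallyClosed.isIntegral_iff.1 h2
  refine ⟨b, Subtype.ext ?_⟩
  rw [← hx, ← hb]
  rfl

theorem exists_of_fixed {σ : E ≃ₐ[F] E} (h : IsUnramifiedQuadratic F E σ) (x : intE F E)
    (hx : σ x = x) : ∃ a : 𝒪[F], algebraMap 𝒪[F] (intE F E) a = x := by
  obtain ⟨a, ha⟩ := mem_range_of_fixed h (x : E) hx
  exact exists_of_isIntegral x a ha

theorem exists_trace {σ : E ≃ₐ[F] E} (h : IsUnramifiedQuadratic F E σ) (r : ℕ)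
    (z : intModE F E r) :
    ∃ a : intMod F r, algebraMap (intMod F r) (intModE F E r) a = z + sigmaMod σ r z := by
  obtain ⟨x, rfl⟩ := Ideal.Quotient.mk_surjective z
  obtain ⟨a, ha⟩ := exists_of_fixed h (x + sigmaInt σ x) (by
    change σ (x + σ x) = x + σ x
    rw [map_add, sigma_sigma h, add_comm])
  refine ⟨Ideal.Quotient.mk _ a, ?_⟩
  rw [sigmaMod_mk, ← map_add, ← ha]
  rfl

theorem exists_norm {σ : E ≃ₐ[F] E} (h : IsUnramifiedQuadratic F E σ) (r : ℕ)
    (z : intModE F E r) :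
    ∃ a : intMod F r, algebraMap (intMod F r) (intModE F E r) a = z * sigmaMod σ r z := by
  obtain ⟨x, rfl⟩ := Ideal.Quotient.mk_surjective z
  obtain ⟨a, ha⟩ := exists_of_fixed h (x * sigmaInt σ x) (by
    change σ (x * σ x) = x * σ x
    rw [map_mul, sigma_sigma h, mul_comm])
  refine ⟨Ideal.Quotient.mk _ a, ?_⟩
  rw [sigmaMod_mk, ← map_mul, ← ha]
  rfl

theorem sigmaMod_sigmaMod {σ : E ≃ₐ[F] E} (h : IsUnramifiedQuadratic F E σ) (r : ℕ)
    (z : intModE F E r) : sigmaMod σ r (sigmaMod σ r z) = z := by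
  obtain ⟨x, rfl⟩ := Ideal.Quotient.mk_surjective z
  rw [sigmaMod_mk, sigmaMod_mk]
  exact congrArg _ (Subtype.ext (sigma_sigma h (x : E)))

theorem sigmaMod_algebraMap (σ : E ≃ₐ[F] E) (r : ℕ) (a : intMod F r) :
    sigmaMod σ r (algebraMap _ _ a) = algebraMap _ _ a := by
  obtain ⟨x, rfl⟩ := Ideal.Quotient.mk_surjective a
  exact congrArg _ ((sigmaInt σ).commutes x)

variable (F E) in
theorem algebraMap_mod_injective (r : ℕ) :
    Function.Injective (algebraMap (intMod F r) (intModE F E r)) := by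
  rw [injective_iff_map_eq_zero]
  intro a ha
  obtain ⟨x, rfl⟩ := Ideal.Quotient.mk_surjective a
  obtain ⟨ϖ, hϖ⟩ := IsDiscreteValuationRing.exists_irreducible 𝒪[F]
  have h1 : algebraMap 𝒪[F] (intE F E) x ∈
      (𝓂[F] ^ r).map (algebraMap 𝒪[F] (intE F E)) := Ideal.Quotient.eq_zero_iff_mem.1 ha
  rw [hϖ.maximalIdeal_eq, Ideal.span_singleton_pow, Ideal.map_span, Set.image_singleton,
    Ideal.mem_span_singleton] at h1
  obtain ⟨y, hy⟩ := h1
  have hne : ((ϖ ^ r : 𝒪[F]) : F) ≠ 0 := by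
    simpa using fun h => absurd h hϖ.ne_zero
  have hy' : algebraMap F E x = algebraMap F E ((ϖ ^ r : 𝒪[F]) : F) * y :=
    congrArg (Subtype.val) hy
  obtain ⟨b, hb⟩ := exists_of_isIntegral y ((x : F) / ((ϖ ^ r : 𝒪[F]) : F)) (by
    rw [map_div₀, hy', mul_div_cancel_left₀]
    simpa using hne)
  apply Ideal.Quotient.eq_zero_iff_mem.2
  rw [hϖ.maximalIdeal_eq, Ideal.span_singleton_pow, Ideal.mem_span_singleton]
  refine ⟨b, Subtype.ext ((algebraMap F E).injective ?_)⟩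
  have hb' : algebraMap F E (b : F) = y := congrArg Subtype.val hb
  rw [hy', ← hb', ← map_mul]
  rfl

/-- The trace `Tr : 𝒪_r^E → 𝒪_r`, `z ↦ z + σ(z)`. -/
noncomputable def trMod {σ : E ≃ₐ[F] E} (h : IsUnramifiedQuadratic F E σ) (r : ℕ)
    (z : intModE F E r) : intMod F r := (exists_trace h r z).choose

/-- The norm `N : 𝒪_r^E → 𝒪_r`, `z ↦ z σ(z)`. -/
noncomputable def nmMod {σ : E ≃ₐ[F] E} (h : IsUnramifiedQuadratic F E σ) (r : ℕ)
    (z : intModE F E r) : intMod F r := (exists_norm h r z).choose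

theorem algebraMap_trMod {σ : E ≃ₐ[F] E} (h : IsUnramifiedQuadratic F E σ) (r : ℕ)
    (z : intModE F E r) :
    algebraMap (intMod F r) (intModE F E r) (trMod h r z) = z + sigmaMod σ r z :=
  (exists_trace h r z).choose_spec

theorem algebraMap_nmMod {σ : E ≃ₐ[F] E} (h : IsUnramifiedQuadratic F E σ) (r : ℕ)
    (z : intModE F E r) :
    algebraMap (intMod F r) (intModE F E r) (nmMod h r z) = z * sigmaMod σ r z :=
  (exists_norm h r z).choose_spec

/-- The image of `ϖ` in `𝒪_r`. -/
noncomputable abbrev unifMod (ϖ : 𝒪[F]) (r : ℕ) : intMod F r := Ideal.Quotient.mk (𝓂[F] ^ r) ϖ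

/-- The image of `ϖ` in `𝒪_r^E`. -/
noncomputable abbrev unifModE (E : Type*) [Field E] [Algebra F E] (ϖ : 𝒪[F]) (r : ℕ) : intModE F E r :=
  algebraMap (intMod F r) (intModE F E r) (unifMod ϖ r)

theorem unifMod_pow_mul_pow {ϖ : 𝒪[F]} (hϖ : Irreducible ϖ) {r l : ℕ} (hr : r = 2 * l) :
    unifMod ϖ r ^ l * unifMod ϖ r ^ l = 0 := by
  rw [← pow_add, ← two_mul, ← hr, ← map_pow]
  exact Ideal.Quotient.eq_zero_iff_mem.2 (Ideal.pow_mem_pow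
    (hϖ.maximalIdeal_eq ▸ Ideal.mem_span_singleton_self ϖ) r)

/-- The additive character `ψ` of `𝒪_r` has level `r`: it is nontrivial on `ϖ^{r-1} 𝒪_r`. -/
def IsLevel (ϖ : 𝒪[F]) (r : ℕ) (ψ : AddChar (intMod F r) ℂ) : Prop :=
  ∃ x, ψ (unifMod ϖ r ^ (r - 1) * x) ≠ 1

/-- The pair `(ν, ν')` of characters of `(𝒪_r^E)ˣ` is regular: on the group of the `1 + ϖ^l z` with
`σ(z) = -z`, the character `ν ν'⁻¹` has level `l`, that is, it is nontrivial on the subgroup of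
the `1 + ϖ^{r-1} z` with `σ(z) = -z` (where `r = 2 l`). -/
def IsRegularPair (σ : E ≃ₐ[F] E) (ϖ : 𝒪[F]) (r : ℕ) (ν ν' : MulChar (intModE F E r) ℂ) : Prop :=
  ∃ z : intModE F E r, sigmaMod σ r z = -z ∧
    (ν * ν'⁻¹) (1 + unifModE E ϖ r ^ (r - 1) * z) ≠ 1

/-- `τ` is attached to the pair `(ν, ν')`: `τ - σ(τ)` is nonzero modulo `ϖ`, and
`ν(1 + ϖ^l (x + yτ)) ν'(1 + ϖ^l (x + yσ(τ))) = ψ(ϖ^l τ(x + yτ) + ϖ^l σ(τ)(x + yσ(τ)))` for all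
`x, y ∈ 𝒪_r`. The condition only depends on `τ` modulo `ϖ^l`. -/
def IsAttached {σ : E ≃ₐ[F] E} (h : IsUnramifiedQuadratic F E σ) (ϖ : 𝒪[F]) (r l : ℕ)
    (ψ : AddChar (intMod F r) ℂ) (ν ν' : MulChar (intModE F E r) ℂ) (τ : intModE F E r) : Prop :=
  τ - sigmaMod σ r τ ∉ Ideal.span {unifModE E ϖ r} ∧
  ∀ x y : intMod F r,
    ν (1 + unifModE E ϖ r ^ l * (algebraMap _ _ x + algebraMap _ _ y * τ)) *
      ν' (1 + unifModE E ϖ r ^ l * (algebraMap _ _ x + algebraMap _ _ y * sigmaMod σ r τ)) =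
    ψ (unifMod ϖ r ^ l * trMod h r (τ * (algebraMap _ _ x + algebraMap _ _ y * τ)))

/-- The character `ν ⊠ ν' = θ_{ν,ν'} ψ_β` of `T = S K_l`, where `β` is the companion matrix
of `X² - Tr(τ) X + N(τ)`. -/
noncomputable def cuspidalChar {σ : E ≃ₐ[F] E} (h : IsUnramifiedQuadratic F E σ) {ϖ : 𝒪[F]}
    (hϖ : Irreducible ϖ) {r l : ℕ} (hr : r = 2 * l)
    (ψ : AddChar (intMod F r) ℂ) (ν ν' : MulChar (intModE F E r) ℂ) (τ : intModE F E r)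
    (hτ : IsAttached h ϖ r l ψ ν ν' τ) :
    ↥(inertia (nmMod h r τ) (trMod h r τ) (unifMod ϖ r) l) →* ℂˣ :=
  boxChar (nmMod h r τ) (trMod h r τ) τ (sigmaMod σ r τ)
    (by rw [algebraMap_trMod, algebraMap_nmMod]; ring)
    (by rw [algebraMap_trMod, algebraMap_nmMod]; ring)
    ν ν' ψ (unifMod ϖ r) l (unifMod_pow_mul_pow hϖ hr)
    (by
      intro x y
      have h1 := hτ.2 x y
      have h2 : trMod h r (τ * (algebraMap _ _ x + algebraMap _ _ y * τ))
          = x * trMod h r τ + y * (trMod h r τ * trMod h r τ - 2 * nmMod h r τ) := by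
        apply algebraMap_mod_injective F E r
        simp only [map_add, map_mul, map_sub, map_ofNat, algebraMap_trMod, algebraMap_nmMod,
          sigmaMod_algebraMap]
        ring
      rw [h2] at h1
      rw [map_pow]
      exact h1)

/-- The cuspidal representation `𝒞_{ν,ν'}` of `GL(2, 𝒪_r)`, induced from the character `ν ⊠ ν'` of
`T = S K_l`. -/
noncomputable def cuspidalRep {σ : E ≃ₐ[F] E} (h : IsUnramifiedQuadratic F E σ) {ϖ : 𝒪[F]}
    (hϖ : Irreducible ϖ) {r l : ℕ} (hr : r = 2 * l)
    (ψ : AddChar (intMod F r) ℂ) (ν ν' : MulChar (intModE F E r) ℂ) (τ : intModE F E r)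
    (hτ : IsAttached h ϖ r l ψ ν ν' τ) :=
  Representation.ind (inertia (nmMod h r τ) (trMod h r τ) (unifMod ϖ r) l).subtype
    (oneDim (cuspidalChar h hϖ hr ψ ν ν' τ hτ))

end Local
end CuspidalGL2

/-!
Write the elliptic element as `g = α + ϖ ^ i β X` with `X = (0, ε; 1, 0)`, so that `X² = ε`, and
write `τ = h + η Φ`, so that the companion matrix `β_τ` is conjugate to `h + η X`; here `η` is a
unit because `τ` and `σ(τ)` differ modulo `ϖ`.

By Frobenius' formula (`card_mul_character_ind`), the character at `g` is `1 / |T|` times the sum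
over `x ∈ G` of the extension by zero of `ν ⊠ ν'`, evaluated at `x g x⁻¹`. The summand
depends only on the coset of `x` modulo `S`, that is, on the conjugate `γ = x⁻¹ β_τ x`. The
conjugates of `β_τ` are the matrices with the same trace and determinant, since their reductions
modulo `ϖ` are irreducible. These are the `γ = h + u X + W`, where `W = (a, -ε c; c, -a)`
anticommutes with `X` and `a² - ε c² = ε (η² - u²)` (`sum_affine_eq`). As `T` is the centralizer of
`β_τ` modulo `ϖ ^ l`, the conjugate of `g` lies in `T` exactly when `W` vanishes modulo
`ϖ ^ (l - i)` (`conj_ellipticElt_mem_iff`), and then the value of `ν ⊠ ν'` is a function `f(u)` of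
`u` alone (`boxChar_conj_ellipticElt_of_le`, `boxChar_conj_ellipticElt_of_lt`).

Hence `q ^ r` times the character is the sum over `u` of `f(u)`, weighted by the number of
`(a, c)` with `a² - ε c² = ε (η² - u²)` and `a, c ∈ ϖ ^ (l - i) R`. The norm form is anisotropic
modulo `ϖ` and represents every unit, so that this weight depends only on the valuation of
`η² - u²`. If `i = 0`, the weight is supported at `u = ±η`. If `i > 0`, the function `f` transforms
under translation by `ϖ ^ (r - 1 - i) R` through a nontrivial character (see `stationaryValue_add`
for `i < l`), while the weight is invariant under this translation except on the neighbourhoods of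
`u = ±η`. So only these neighbourhoods contribute (`sum_stationary`). There, completing the square
(`bijective_sq_sub`) reduces the sum to the total excess of the weight over its value at valuation
`r - 1 - i`, which is `q ^ r (-q) ^ i` by counting the solutions of `ϖ ^ k ∣ a² - ε c²`
(`sum_restrictedCount_sub`). The values `f(η)` and `f(-η)` are the two terms of the formula.

An element `τ` exists because `ψ` is a primitive character: every character of `R` that is trivial
on `ϖ ^ l R` is of the form `x ↦ ψ (ϖ ^ l a x)` (`exists_eq_mulShift`). Applied to the coordinates
with respect to `1` and `Φ`, this gives `h` and `η`, and regularity says that `η` is a unit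
(`exists_dual_parameter`).
-/

namespace CuspidalGL2

/-! ### The character of an induced representation -/

section InducedCharacter

open scoped TensorProduct

variable {G : Type*} [Group G] (T : Subgroup G) (χ : T →* ℂˣ)

open Classical in
/-- The extension by zero of a character of a subgroup to the whole group. -/
noncomputable def extendByZero (x : G) : ℂ := if h : x ∈ T then (χ ⟨x, h⟩ : ℂ) else 0

variable {T} in
theorem extendByZero_of_mem {x : G} (h : x ∈ T) : extendByZero T χ x = χ ⟨x, h⟩ := dif_pos h

variable {T} in
theorem extendByZero_of_notMem {x : G} (h : x ∉ T) : extendByZero T χ x = 0 := dif_neg h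

theorem extendByZero_mul_left (t : T) (x : G) :
    extendByZero T χ (t * x) = χ t * extendByZero T χ x := by
  by_cases h : x ∈ T
  · rw [extendByZero_of_mem χ h, extendByZero_of_mem χ (T.mul_mem t.2 h), ← Units.val_mul,
      ← map_mul]
    rfl
  · rw [extendByZero_of_notMem χ h, mul_zero, extendByZero_of_notMem]
    rwa [T.mul_mem_cancel_left t.2]

theorem extendByZero_mul_right (t : T) (x : G) :
    extendByZero T χ (x * t) = extendByZero T χ x * χ t := by
  by_cases h : x ∈ T
  · rw [extendByZero_of_mem χ h, extendByZero_of_mem χ (T.mul_mem h t.2), ← Units.val_mul,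
      ← map_mul]
    rfl
  · rw [extendByZero_of_notMem χ h, zero_mul, extendByZero_of_notMem]
    rwa [T.mul_mem_cancel_right t.2]

theorem extendByZero_conj (t : T) (x : G) :
    extendByZero T χ (t * x * (t : G)⁻¹) = extendByZero T χ x := by
  have := extendByZero_mul_right T χ t⁻¹ (t * x)
  rw [extendByZero_mul_left, Subgroup.coe_inv] at this
  rw [this, mul_right_comm, ← Units.val_mul, ← map_mul, mul_inv_cancel]
  simp

omit [Group G] in
theorem constr_basis_single (k : Type*) [CommRing k] {M : Type*} [AddCommGroup M] [Module k M]
    (f : G → M) (x : G) :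
    (MonoidAlgebra.basis G k).constr k f (MonoidAlgebra.single x 1) = f x := by
  rw [← MonoidAlgebra.basis_apply, Module.Basis.constr_basis]

/-- The relation `t x ⊗ χ(t) a = x ⊗ a` in the induced representation. -/
theorem indMk_mul_left (t : T) (x : G) (a : ℂ) :
    Representation.IndV.mk T.subtype (oneDim χ) (t * x) (χ t * a)
      = Representation.IndV.mk T.subtype (oneDim χ) x a := by
  have h := Representation.Coinvariants.mk_self_apply
    (Representation.tprod ((Representation.leftRegular ℂ G).comp T.subtype) (oneDim χ)) t
    (MonoidAlgebra.single x 1 ⊗ₜ[ℂ] a)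
  have e : oneDim χ t a = χ t * a := by simp [oneDim]
  rw [← e]
  simpa using h

/-- The linear map from the induced representation to functions on `G` that sends the class of
`x ⊗ a` to `y ↦ χ(y x⁻¹) a`, where `χ` is extended by zero. -/
noncomputable def ofInd : Representation.IndV T.subtype (oneDim χ) →ₗ[ℂ] (G → ℂ) :=
  Representation.Coinvariants.lift _
    (TensorProduct.lift ((MonoidAlgebra.basis G ℂ).constr ℂ (fun x : G =>
      LinearMap.pi (fun y : G => LinearMap.mulLeft ℂ (extendByZero T χ (y * x⁻¹)))))) (by
      intro t
      refine TensorProduct.ext ?_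
      refine (MonoidAlgebra.basis G ℂ).ext fun x => LinearMap.ext_ring (funext fun y => ?_)
      have h : extendByZero T χ (y * ((t : G) * x)⁻¹) * χ t = extendByZero T χ (y * x⁻¹) := by
        rw [mul_inv_rev, ← mul_assoc, ← extendByZero_mul_right]
        simp
      have e1 : oneDim χ t 1 = (χ t : ℂ) := by simp [oneDim]
      simpa [constr_basis_single, e1, -Module.Basis.constr_apply_fintype] using h)

theorem ofInd_mk (x y : G) (a : ℂ) :
    ofInd T χ (Representation.IndV.mk T.subtype (oneDim χ) x a) y
      = extendByZero T χ (y * x⁻¹) * a := by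
  simp [ofInd, constr_basis_single, -Module.Basis.constr_apply_fintype]

variable [Fintype G]

/-- The linear map from functions on `G` to the induced representation that sends the indicator
function of `y` to the class of `y ⊗ 1`. -/
noncomputable def toInd : (G → ℂ) →ₗ[ℂ] Representation.IndV T.subtype (oneDim χ) :=
  ∑ y : G, Representation.IndV.mk T.subtype (oneDim χ) y ∘ₗ LinearMap.proj y

theorem toInd_apply (f : G → ℂ) :
    toInd T χ f = ∑ y : G, Representation.IndV.mk T.subtype (oneDim χ) y (f y) := by
  rw [toInd, LinearMap.sum_apply]
  rfl

theorem toInd_single (y : G) (a : ℂ) [DecidableEq G] :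
    toInd T χ (Pi.single y a) = Representation.IndV.mk T.subtype (oneDim χ) y a := by
  rw [toInd_apply, Finset.sum_eq_single y]
  · simp
  · intro z _ hz
    simp [Pi.single_eq_of_ne hz]
  · simp

/-- Up to the factor `|T|`, the map `ofInd` is a section of `toInd`, so that traces on the induced
representation can be computed on functions on `G`. -/
theorem toInd_ofInd (v : Representation.IndV T.subtype (oneDim χ)) :
    toInd T χ (ofInd T χ v) = (Nat.card T : ℂ) • v := by
  classical
  have key : toInd T χ ∘ₗ ofInd T χ = (Nat.card T : ℂ) • LinearMap.id := by
    refine Representation.IndV.hom_ext _ _ fun x => LinearMap.ext_ring ?_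
    change toInd T χ (ofInd T χ (Representation.IndV.mk T.subtype (oneDim χ) x 1))
      = (Nat.card T : ℂ) • Representation.IndV.mk T.subtype (oneDim χ) x 1
    rw [toInd_apply]
    simp only [ofInd_mk, mul_one]
    rw [← Equiv.sum_comp (Equiv.mulRight x)]
    simp only [Equiv.coe_mulRight, mul_inv_cancel_right]
    have h : ∀ z : G, Representation.IndV.mk T.subtype (oneDim χ) (z * x) (extendByZero T χ z)
        = if z ∈ T then Representation.IndV.mk T.subtype (oneDim χ) x 1 else 0 := by
      intro z
      split_ifs with hz
      · rw [extendByZero_of_mem χ hz]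
        simpa using indMk_mul_left T χ ⟨z, hz⟩ x 1
      · rw [extendByZero_of_notMem χ hz, map_zero]
    rw [Finset.sum_congr rfl fun z _ => h z, ← Finset.sum_filter, Finset.sum_const,
      ← Nat.cast_smul_eq_nsmul ℂ, Nat.card_eq_fintype_card, Fintype.card_subtype]
  exact LinearMap.congr_fun key v

/-- Frobenius' formula for the character of a representation induced from a one-dimensional
character. -/
theorem card_mul_character_ind (g : G) :
    (Nat.card T : ℂ) * (Representation.ind T.subtype (oneDim χ)).character g
      = ∑ x : G, extendByZero T χ (x * g * x⁻¹) := by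
  classical
  have hT : (Nat.card T : ℂ) ≠ 0 := by exact_mod_cast Nat.card_pos.ne'
  have hsurj : Function.Surjective (toInd T χ) := fun v =>
    ⟨(Nat.card T : ℂ)⁻¹ • ofInd T χ v, by
      rw [map_smul, toInd_ofInd, smul_smul, inv_mul_cancel₀ hT, one_smul]⟩
  have : Module.Finite ℂ (Representation.IndV T.subtype (oneDim χ)) :=
    Module.Finite.of_surjective _ hsurj
  have h1 : (Nat.card T : ℂ) • Representation.ind T.subtype (oneDim χ) g
      = (Representation.ind T.subtype (oneDim χ) g ∘ₗ toInd T χ) ∘ₗ ofInd T χ := by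
    refine LinearMap.ext fun w => ?_
    simp [toInd_ofInd]
  rw [Representation.character, ← smul_eq_mul, ← map_smul, h1, LinearMap.trace_comp_comm',
    LinearMap.trace_eq_matrix_trace ℂ (Pi.basisFun ℂ G), Matrix.trace]
  refine Finset.sum_congr rfl fun y _ => ?_
  rw [Matrix.diag_apply, LinearMap.toMatrix_apply, Pi.basisFun_apply, Pi.basisFun_repr,
    LinearMap.comp_apply, LinearMap.comp_apply, toInd_single, Representation.ind_mk, ofInd_mk]
  simp [mul_assoc]

end InducedCharacter

/-! ### Truncated discrete valuation rings and norm forms -/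

/-- `R` behaves like a discrete valuation ring with uniformizer `ϖ` and residue field of odd
cardinality `q`, truncated at level `r`. These are the properties of `𝒪 / ϖ ^ r 𝒪` that are used
below. -/
structure IsTruncatedDVR {R : Type*} [CommRing R] (ϖ : R) (r q : ℕ) : Prop where
  isUnit_or_dvd : ∀ x : R, IsUnit x ∨ ϖ ∣ x
  pow_eq_zero : ϖ ^ r = 0
  dvd_of_mul_eq_zero : ∀ k ≤ r, ∀ x : R, ϖ ^ k * x = 0 → ϖ ^ (r - k) ∣ x
  card_dvd : ∀ k ≤ r, Nat.card {x : R // ϖ ^ k ∣ x} = q ^ (r - k)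
  isUnit_two : IsUnit (2 : R)
  one_lt : 1 < q

namespace IsTruncatedDVR

variable {R : Type*} [CommRing R] {ϖ : R} {r q : ℕ} (H : IsTruncatedDVR ϖ r q)
include H

/-- A power of `ϖ` may be cancelled in a divisibility, although `ϖ` is a zero divisor. -/
theorem dvd_cancel {j k : ℕ} (hj : j ≤ r) {x : R} (h : ϖ ^ j ∣ ϖ ^ k * x) : ϖ ^ (j - k) ∣ x := by
  rcases le_total j k with hjk | hjk
  · simp [Nat.sub_eq_zero_of_le hjk]
  obtain ⟨y, hy⟩ := h
  have h1 : ϖ ^ k * (x - ϖ ^ (j - k) * y) = 0 := by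
    rw [mul_sub, hy, ← mul_assoc, ← pow_add, Nat.add_sub_cancel' hjk, sub_self]
  have h2 := H.dvd_of_mul_eq_zero k (hjk.trans hj) _ h1
  have h3 := (pow_dvd_pow ϖ (Nat.sub_le_sub_right hj k)).trans h2
  simpa using dvd_add h3 (dvd_mul_right (ϖ ^ (j - k)) y)

theorem exists_eq_pow_mul_unit (m : ℕ) {x : R} (h : ¬ ϖ ^ m ∣ x) :
    ∃ e < m, ∃ d : R, IsUnit d ∧ x = ϖ ^ e * d := by
  induction m generalizing x with
  | zero => simp at h
  | succ m ih =>
    rcases H.isUnit_or_dvd x with hx | ⟨y, rfl⟩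
    · exact ⟨0, by omega, x, hx, by simp⟩
    · obtain ⟨e, he, d, hd, rfl⟩ := ih (x := y) fun hy => h (by
        rw [pow_succ']; exact mul_dvd_mul_left _ hy)
      exact ⟨e + 1, by omega, d, hd, by ring⟩

variable [Nontrivial R]

theorem not_isUnit : ¬ IsUnit ϖ := fun h => by
  have := h.pow r
  rw [H.pow_eq_zero] at this
  exact not_isUnit_zero this

theorem isUnit_iff {x : R} : IsUnit x ↔ ¬ ϖ ∣ x :=
  ⟨fun h h' => H.not_isUnit (isUnit_of_dvd_unit h' h), fun h => (H.isUnit_or_dvd x).resolve_right h⟩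

theorem dvd_iff {x : R} : ϖ ∣ x ↔ ¬ IsUnit x := by rw [H.isUnit_iff, not_not]

theorem isUnit_of_dvd_sub {x y : R} (h : IsUnit x) (hd : ϖ ∣ x - y) : IsUnit y := by
  rw [H.isUnit_iff] at h ⊢
  intro h'
  exact h (by simpa using dvd_add hd h')

theorem isUnit_add {x y : R} (h : IsUnit x) (hd : ϖ ∣ y) : IsUnit (x + y) :=
  H.isUnit_of_dvd_sub h (by simpa using hd)

theorem dvd_of_dvd_sq {x : R} (h : ϖ ∣ x ^ 2) : ϖ ∣ x := by
  rw [H.dvd_iff] at h ⊢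
  exact fun h' => h (h'.pow 2)

/-- Completing the square is a permutation of `ϖ ^ k R`, a form of Hensel's lemma. -/
theorem bijective_sq_sub [Finite R] {e : R} (he : IsUnit e) {k : ℕ} (hk : 0 < k) :
    Function.Bijective (fun x : {x : R // ϖ ^ k ∣ x} =>
      (⟨x * (2 * e + x), Dvd.dvd.mul_right x.2 _⟩ : {x : R // ϖ ^ k ∣ x})) := by
  refine Finite.injective_iff_bijective.1 ?_
  rintro ⟨x, hx⟩ ⟨y, hy⟩ hxy
  have hxy' : x * (2 * e + x) = y * (2 * e + y) := congrArg Subtype.val hxy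
  have hd : ϖ ∣ x + y := (dvd_pow_self ϖ hk.ne').trans (dvd_add hx hy)
  have hu : IsUnit (2 * e + (x + y)) := H.isUnit_add (H.isUnit_two.mul he) hd
  have h0 : (2 * e + (x + y)) * (x - y) = 0 := by linear_combination hxy'
  exact Subtype.ext (sub_eq_zero.1 (hu.mul_right_eq_zero.1 h0))

theorem isSquare_of_dvd_sub_one [Finite R] {x : R} (hx : ϖ ∣ x - 1) : IsSquare x := by
  obtain ⟨⟨y, _⟩, hy⟩ := (H.bijective_sq_sub isUnit_one one_pos).2 ⟨x - 1, by simpa using hx⟩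
  have hy' : y * (2 * 1 + y) = x - 1 := congrArg Subtype.val hy
  exact ⟨1 + y, by linear_combination -hy'⟩

theorem isSquare_of_dvd_sub [Finite R] {x y : R} (hy : IsUnit y) (h : ϖ ∣ x - y ^ 2) :
    IsSquare x := by
  obtain ⟨v, hv⟩ := hy.exists_right_inv
  obtain ⟨s, hs⟩ := H.isSquare_of_dvd_sub_one (x := x * v ^ 2) (by
    obtain ⟨z, hz⟩ := h
    exact ⟨z * v ^ 2, by linear_combination v ^ 2 * hz + (y * v + 1) * hv⟩)
  exact ⟨y * s, by linear_combination y ^ 2 * hs - x * (y * v + 1) * hv⟩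

section Norm

variable [Finite R] {ε : R} (hε : IsUnit ε) (hsq : ¬ IsSquare ε)
include hε hsq

/-- The norm form `a² - ε b²` is anisotropic modulo `ϖ`. -/
theorem dvd_of_dvd_norm {a b : R} (h : ϖ ∣ a ^ 2 - ε * b ^ 2) : ϖ ∣ a ∧ ϖ ∣ b := by
  have hb : ϖ ∣ b := by
    by_contra hb
    obtain ⟨v, hv⟩ := (H.isUnit_iff.2 hb).exists_right_inv
    have h1 : ϖ ∣ ε - (a * v) ^ 2 := by
      obtain ⟨z, hz⟩ := h
      exact ⟨-z * v ^ 2, by linear_combination (-v ^ 2) * hz - ε * (b * v + 1) * hv⟩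
    refine hsq (H.isSquare_of_dvd_sub (H.isUnit_iff.2 fun h2 => ?_) h1)
    have h3 : ϖ ∣ ε := by simpa using dvd_add h1 (Dvd.dvd.pow h2 two_ne_zero)
    exact H.isUnit_iff.1 hε h3
  refine ⟨H.dvd_of_dvd_sq ?_, hb⟩
  have : ϖ ∣ ε * b ^ 2 := Dvd.dvd.mul_left (Dvd.dvd.pow hb two_ne_zero) _
  simpa using dvd_add h this

theorem pow_dvd_norm_iff {k : ℕ} (hk : k ≤ r) {a b : R} :
    ϖ ^ k ∣ a ^ 2 - ε * b ^ 2 ↔ ϖ ^ ((k + 1) / 2) ∣ a ∧ ϖ ^ ((k + 1) / 2) ∣ b := by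
  constructor
  · induction k using Nat.strong_induction_on generalizing a b with
    | _ k ih =>
      intro h
      rcases Nat.eq_zero_or_pos k with rfl | hk0
      · simp
      obtain ⟨⟨a, rfl⟩, ⟨b, rfl⟩⟩ :=
        H.dvd_of_dvd_norm hε hsq ((dvd_pow_self ϖ hk0.ne').trans h)
      rcases Nat.lt_or_ge k 2 with hk2 | hk2
      · obtain rfl : k = 1 := by omega
        simp
      have h1 : ϖ ^ (k - 2) ∣ a ^ 2 - ε * b ^ 2 := by
        apply H.dvd_cancel (k := 2) hk
        convert h using 1
        ring
      obtain ⟨h2, h3⟩ := ih (k - 2) (by omega) (by omega) h1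
      have e : (k + 1) / 2 = (k - 2 + 1) / 2 + 1 := by omega
      rw [e, pow_succ']
      exact ⟨mul_dvd_mul_left _ h2, mul_dvd_mul_left _ h3⟩
  · rintro ⟨h1, h2⟩
    have h : ϖ ^ k ∣ (ϖ ^ ((k + 1) / 2)) ^ 2 := by
      rw [← pow_mul]
      exact pow_dvd_pow _ (by omega)
    exact dvd_sub (h.trans (pow_dvd_pow_of_dvd h1 2))
      ((h.trans (pow_dvd_pow_of_dvd h2 2)).mul_left _)

omit hsq in
/-- The norm form `a² - ε b²` represents every unit. -/
theorem exists_norm_eq {v : R} (hv : IsUnit v) : ∃ a b : R, a ^ 2 - ε * b ^ 2 = v := by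
  have : IsLocalRing R := IsLocalRing.of_nonunits_add fun a b ha hb => by
    rw [mem_nonunits_iff, ← H.dvd_iff] at *
    exact dvd_add ha hb
  have hm : ∀ x : R, IsLocalRing.residue R x = 0 ↔ ϖ ∣ x := fun x => by
    rw [IsLocalRing.residue_eq_zero_iff, IsLocalRing.mem_maximalIdeal, mem_nonunits_iff,
      H.dvd_iff]
  let K := IsLocalRing.ResidueField R
  have : Finite K := Finite.of_surjective _ IsLocalRing.residue_surjective
  let _ : Fintype K := Fintype.ofFinite K
  have h2 : ringChar K ≠ 2 := fun h => by
    have h3 : ((2 : ℕ) : K) = 0 := by rw [← h]; exact ringChar.Nat.cast_ringChar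
    have h4 : IsLocalRing.residue R 2 = 0 := by rw [map_ofNat]; exact_mod_cast h3
    exact H.isUnit_iff.1 H.isUnit_two ((hm _).1 h4)
  have hε' : IsLocalRing.residue R ε ≠ 0 := fun h => H.isUnit_iff.1 hε ((hm _).1 h)
  open Polynomial in
  obtain ⟨a, b, hab⟩ := FiniteField.exists_root_sum_quadratic
    (f := (X ^ 2 : K[X])) (g := C (-IsLocalRing.residue R ε) * X ^ 2 + C 0 * X
      + C (-IsLocalRing.residue R v))
    (by simp) (Polynomial.degree_quadratic (neg_ne_zero.2 hε'))
    (FiniteField.odd_card_of_char_ne_two h2)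
  obtain ⟨a, rfl⟩ := IsLocalRing.residue_surjective a
  obtain ⟨b, rfl⟩ := IsLocalRing.residue_surjective b
  have h5 : ϖ ∣ (a ^ 2 - ε * b ^ 2) - v := by
    rw [← hm]
    simp only [map_sub, map_mul, map_pow]
    simp at hab
    linear_combination hab
  have h6 : IsUnit (a ^ 2 - ε * b ^ 2) := H.isUnit_of_dvd_sub hv (by
    rw [← neg_sub]; exact h5.neg_right)
  obtain ⟨w, hw⟩ := h6.exists_right_inv
  -- the quotient of `v` by the approximate solution is a square
  obtain ⟨s, hs⟩ := H.isSquare_of_dvd_sub_one (x := v * w) (by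
    obtain ⟨z, hz⟩ := h5
    exact ⟨-z * w, by linear_combination (-w) * hz + hw⟩)
  exact ⟨a * s, b * s, by linear_combination (-(a ^ 2 - ε * b ^ 2)) * hs + v * hw⟩

end Norm

open scoped Classical in
/-- The number of `(a, b)` with `a² - ε b² = D`. -/
noncomputable def normCount [Fintype R] (ε D : R) : ℕ :=
  (Finset.univ.filter fun p : R × R => p.1 ^ 2 - ε * p.2 ^ 2 = D).card

section Count

open scoped Classical

variable [Fintype R] {ε : R} (hε : IsUnit ε) (hsq : ¬ IsSquare ε)

include hε in
/-- The number of solutions of `a² - ε b² = D` depends only on the valuation of `D`, because the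
norm is multiplicative and represents every unit. -/
theorem normCount_mul_unit (D : R) {v : R} (hv : IsUnit v) :
    normCount ε (D * v) = normCount ε D := by
  have key : ∀ (D v : R), IsUnit v → normCount ε D ≤ normCount ε (D * v) := by
    intro D v hv
    obtain ⟨x, y, hxy⟩ := H.exists_norm_eq hε hv
    refine Finset.card_le_card_of_injOn (fun p => (p.1 * x + ε * p.2 * y, p.1 * y + p.2 * x))
      ?_ ?_
    · rintro ⟨a, b⟩ hp
      simp only [Finset.coe_filter, Finset.mem_univ, true_and, Set.mem_ofPred_eq] at hp ⊢
      rw [← hp, ← hxy]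
      ring
    · rintro ⟨a, b⟩ - ⟨a', b'⟩ - h
      obtain ⟨h1, h2⟩ := Prod.mk.inj h
      obtain ⟨w, hw⟩ := hv.exists_right_inv
      rw [← hxy] at hw
      refine Prod.ext ?_ ?_
      · linear_combination w * x * h1 - w * ε * y * h2 - (a - a') * hw
      · linear_combination w * x * h2 - w * y * h1 - (b - b') * hw
  obtain ⟨w, hw⟩ := hv.exists_right_inv
  refine le_antisymm ?_ (key D v hv)
  have := key (D * v) w (IsUnit.of_mul_eq_one v (by rw [mul_comm]; exact hw))
  rwa [mul_assoc, hw, mul_one] at this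

omit [Nontrivial R] in
theorem card_filter_dvd {k : ℕ} (hk : k ≤ r) :
    (Finset.univ.filter fun x : R => ϖ ^ k ∣ x).card = q ^ (r - k) := by
  rw [← H.card_dvd k hk, Nat.card_eq_fintype_card, Fintype.card_subtype]

include hε hsq in
/-- The number of `(a, b)` such that `ϖ ^ k` divides `a² - ε b²`. -/
theorem sum_normCount {k : ℕ} (hk : k ≤ r) :
    ∑ D ∈ Finset.univ.filter (fun x : R => ϖ ^ k ∣ x), normCount ε D
      = (q ^ (r - (k + 1) / 2)) ^ 2 := by
  have h1 := Finset.card_eq_sum_card_fiberwise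
    (f := fun p : R × R => p.1 ^ 2 - ε * p.2 ^ 2)
    (s := Finset.univ.filter fun p : R × R => ϖ ^ k ∣ p.1 ^ 2 - ε * p.2 ^ 2)
    (t := Finset.univ.filter fun x : R => ϖ ^ k ∣ x) (by intro p; simp)
  have h2 : (Finset.univ.filter fun p : R × R => ϖ ^ k ∣ p.1 ^ 2 - ε * p.2 ^ 2)
      = (Finset.univ.filter fun x : R => ϖ ^ ((k + 1) / 2) ∣ x) ×ˢ
        (Finset.univ.filter fun x : R => ϖ ^ ((k + 1) / 2) ∣ x) := by
    ext p
    simp [H.pow_dvd_norm_iff hε hsq hk]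
  rw [h2, Finset.card_product, H.card_filter_dvd (by omega), ← pow_two] at h1
  rw [h1]
  refine Finset.sum_congr rfl fun D hD => ?_
  rw [normCount, ← h2, Finset.filter_filter]
  congr 1
  ext p
  simp only [Finset.mem_filter, Finset.mem_univ, true_and] at hD ⊢
  constructor
  · rintro rfl; exact ⟨hD, rfl⟩
  · exact fun h => h.2

/-- The number of `(a, b)` with `a² - ε b² = D` and `a, b ∈ ϖ ^ j R`, as a complex number. The
definition uses that, when `2 j ≤ r`, the condition on `a, b` says that `ϖ ^ (2 j)` divides `D`
(see `restrictedCount_eq`); this makes it a function of the valuation of `D`. -/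
noncomputable def restrictedCount (ϖ ε : R) (j : ℕ) (D : R) : ℂ :=
  if ϖ ^ (2 * j) ∣ D then (normCount ε D : ℂ) else 0

include hε hsq in
theorem restrictedCount_eq {j : ℕ} (hj : 2 * j ≤ r) (D : R) :
    restrictedCount ϖ ε j D = (Finset.univ.filter fun p : R × R =>
      p.1 ^ 2 - ε * p.2 ^ 2 = D ∧ ϖ ^ j ∣ p.1 ∧ ϖ ^ j ∣ p.2).card := by
  have e : (2 * j + 1) / 2 = j := by omega
  have h : ∀ p : R × R, ϖ ^ j ∣ p.1 ∧ ϖ ^ j ∣ p.2 ↔ ϖ ^ (2 * j) ∣ p.1 ^ 2 - ε * p.2 ^ 2 := by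
    intro p
    rw [H.pow_dvd_norm_iff hε hsq hj, e]
  simp only [h, restrictedCount, normCount]
  split_ifs with hD
  · congr 2
    ext p
    simp only [Finset.mem_filter, Finset.mem_univ, true_and]
    constructor
    · rintro rfl; exact ⟨rfl, hD⟩
    · exact fun h => h.1
  · symm
    rw [Nat.cast_eq_zero, Finset.card_eq_zero, Finset.filter_eq_empty_iff]
    rintro p - ⟨rfl, h⟩
    exact hD h

include hε in
theorem restrictedCount_mul_unit (j : ℕ) (D : R) {v : R} (hv : IsUnit v) :
    restrictedCount ϖ ε j (D * v) = restrictedCount ϖ ε j D := by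
  rw [restrictedCount, restrictedCount, H.normCount_mul_unit hε D hv]
  simp only [hv.dvd_mul_right]

/-- For `i = 0`, the layer of valuation `r - 1` carries no solutions, because `2 l = r`. -/
theorem restrictedCount_top {l : ℕ} (hl : 0 < l) (hr : r = 2 * l) :
    restrictedCount ϖ ε l (ϖ ^ (r - 1)) = 0 := by
  rw [restrictedCount, if_neg]
  rw [← hr, H.pow_eq_zero, zero_dvd_iff]
  intro h
  have h1 := H.dvd_of_mul_eq_zero (r - 1) (by omega) 1 (by rw [h, zero_mul])
  rw [show r - (r - 1) = 1 by omega, pow_one] at h1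
  exact H.not_isUnit (isUnit_of_dvd_one h1)

include hε hsq in
/-- The elements of valuation exactly `m = r - 1 - i` contribute
`(q ^ (i + 1) - q ^ i) * restrictedCount (ϖ ^ m)` solutions. -/
theorem card_layer_mul_restrictedCount {i l m : ℕ} (hl : 0 < l) (hr : r = 2 * l)
    (hi : m + 1 + i = r) :
    ((q : ℂ) ^ (i + 1) - (q : ℂ) ^ i) * restrictedCount ϖ ε (l - i) (ϖ ^ m)
      = ((q : ℂ) ^ (r - (m + 1) / 2)) ^ 2 - ((q : ℂ) ^ (r - (m + 1 + 1) / 2)) ^ 2 := by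
  rcases Nat.eq_zero_or_pos i with rfl | hi0
  · obtain rfl : m = r - 1 := by omega
    have e : (r - 1 + 1 + 1) / 2 = (r - 1 + 1) / 2 := by omega
    rw [Nat.sub_zero, H.restrictedCount_top hl hr, e, mul_zero, sub_self]
  have hsub : Finset.univ.filter (fun x : R => ϖ ^ (m + 1) ∣ x)
      ⊆ Finset.univ.filter (fun x : R => ϖ ^ m ∣ x) := by
    intro x
    simp only [Finset.mem_filter, Finset.mem_univ, true_and]
    exact fun h => (pow_dvd_pow ϖ (Nat.le_succ m)).trans h
  have h1 := Finset.sum_sdiff (f := normCount ε) hsub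
  have h2 := Finset.card_sdiff_add_card_eq_card hsub
  have h3 : ∀ x ∈ Finset.univ.filter (fun x : R => ϖ ^ m ∣ x) \
      Finset.univ.filter (fun x : R => ϖ ^ (m + 1) ∣ x),
      normCount ε x = normCount ε (ϖ ^ m) := by
    intro x hx
    simp only [Finset.mem_sdiff, Finset.mem_filter, Finset.mem_univ, true_and] at hx
    obtain ⟨⟨y, rfl⟩, hx2⟩ := hx
    refine H.normCount_mul_unit hε _ (H.isUnit_iff.2 fun hy => hx2 ?_)
    rw [pow_succ]
    exact mul_dvd_mul_left _ hy
  rw [Finset.sum_congr rfl h3, Finset.sum_const, smul_eq_mul, H.sum_normCount hε hsq (by omega),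
    H.sum_normCount hε hsq (by omega)] at h1
  rw [H.card_filter_dvd (by omega), H.card_filter_dvd (by omega),
    show r - (m + 1) = i by omega, show r - m = i + 1 by omega] at h2
  have h4 : restrictedCount ϖ ε (l - i) (ϖ ^ m) = normCount ε (ϖ ^ m) := by
    rw [restrictedCount, if_pos (pow_dvd_pow ϖ (by omega))]
  rw [h4]
  have h1' := congrArg (Nat.cast : ℕ → ℂ) h1
  have h2' := congrArg (Nat.cast : ℕ → ℂ) h2
  push_cast at h1' h2'
  rw [← h1', ← h2']
  ring

include hε hsq in
/-- The excess of `restrictedCount` over its value on the layer of valuation `r - 1 - i`, summed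
over the elements of larger valuation, is the Gauss sum `q ^ r * (-q) ^ i`. -/
theorem sum_restrictedCount_sub {i l m : ℕ} (hl : 0 < l) (hr : r = 2 * l) (hi : m + 1 + i = r) :
    ∑ x ∈ Finset.univ.filter (fun x : R => ϖ ^ (m + 1) ∣ x),
      (restrictedCount ϖ ε (l - i) x - restrictedCount ϖ ε (l - i) (ϖ ^ m))
      = (q : ℂ) ^ r * (-(q : ℂ)) ^ i := by
  have hq : (q : ℂ) - 1 ≠ 0 := by
    rw [sub_ne_zero]
    exact_mod_cast H.one_lt.ne'
  have h1 : ∑ x ∈ Finset.univ.filter (fun x : R => ϖ ^ (m + 1) ∣ x),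
      restrictedCount ϖ ε (l - i) x = ((q : ℂ) ^ (r - (m + 1 + 1) / 2)) ^ 2 := by
    have h2 := congrArg (Nat.cast : ℕ → ℂ) (H.sum_normCount hε hsq (k := m + 1) (by omega))
    push_cast at h2
    rw [← h2]
    refine Finset.sum_congr rfl fun x hx => ?_
    simp only [Finset.mem_filter, Finset.mem_univ, true_and] at hx
    rw [restrictedCount, if_pos ((pow_dvd_pow ϖ (by omega)).trans hx)]
  have h2 := H.card_layer_mul_restrictedCount hε hsq hl hr hi
  rw [Finset.sum_sub_distrib, h1, Finset.sum_const, H.card_filter_dvd (by omega),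
    show r - (m + 1) = i by omega, nsmul_eq_mul, Nat.cast_pow]
  -- multiplied by `q - 1`, the second term is given by the number of solutions on the layer
  apply mul_left_cancel₀ hq
  rw [mul_sub, show ((q : ℂ) - 1) * ((q : ℂ) ^ i * restrictedCount ϖ ε (l - i) (ϖ ^ m))
    = ((q : ℂ) ^ (i + 1) - (q : ℂ) ^ i) * restrictedCount ϖ ε (l - i) (ϖ ^ m) by ring, h2]
  rcases Nat.even_or_odd' m with ⟨k, rfl | rfl⟩
  · obtain ⟨s, hs⟩ : ∃ s, r = s + k + 1 := ⟨r - k - 1, by omega⟩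
    have hodd : Odd i := ⟨l - k - 1, by omega⟩
    have e : (q : ℂ) ^ r * (q : ℂ) ^ i = (q : ℂ) ^ (2 * s + 1) := by
      rw [← pow_add]; congr 1; omega
    rw [hodd.neg_pow, mul_neg, e, show r - (2 * k + 1) / 2 = s + 1 by omega,
      show r - (2 * k + 1 + 1) / 2 = s by omega]
    ring
  · obtain ⟨s, hs⟩ : ∃ s, r = s + k + 1 := ⟨r - k - 1, by omega⟩
    have heven : Even i := ⟨l - k - 1, by omega⟩
    have e : (q : ℂ) ^ r * (q : ℂ) ^ i = (q : ℂ) ^ (2 * s) := by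
      rw [← pow_add]; congr 1; omega
    rw [heven.neg_pow, e, show r - (2 * k + 1 + 1) / 2 = s by omega,
      show r - (2 * k + 1 + 1 + 1) / 2 = s by omega]
    ring

end Count
end IsTruncatedDVR

/-! ### Stationary phase -/

namespace IsTruncatedDVR

open scoped Classical

variable {R : Type*} [CommRing R] [Nontrivial R] {ϖ : R} {r q : ℕ} (H : IsTruncatedDVR ϖ r q)
include H

/-- A function `K` of the valuation, made constant on the multiples of `ϖ ^ m`, is invariant under
translation by multiples of `ϖ ^ m`. -/
theorem truncate_add_eq {K : R → ℂ} (hK : ∀ D v : R, IsUnit v → K (D * v) = K D) (m : ℕ)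
    (D y : R) :
    (if ϖ ^ (m + 1) ∣ D + ϖ ^ m * y then K (ϖ ^ m) else K (D + ϖ ^ m * y))
      = if ϖ ^ (m + 1) ∣ D then K (ϖ ^ m) else K D := by
  have h0 : ∀ D : R, ϖ ^ m ∣ D →
      (if ϖ ^ (m + 1) ∣ D then K (ϖ ^ m) else K D) = K (ϖ ^ m) := by
    rintro D ⟨d, rfl⟩
    split_ifs with h
    · rfl
    · refine hK _ _ (H.isUnit_iff.2 fun hd => h ?_)
      rw [pow_succ]
      exact mul_dvd_mul_left _ hd
  by_cases hD : ϖ ^ m ∣ D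
  · rw [h0 _ hD, h0 _ (dvd_add hD (dvd_mul_right _ _))]
  · have hD' : ¬ ϖ ^ m ∣ D + ϖ ^ m * y := fun h => hD (by
      simpa using dvd_sub h (dvd_mul_right (ϖ ^ m) y))
    have hs : ∀ {x : R}, ϖ ^ (m + 1) ∣ x → ϖ ^ m ∣ x := (pow_dvd_pow ϖ (Nat.le_succ m)).trans
    rw [if_neg fun h => hD (hs h), if_neg fun h => hD' (hs h)]
    obtain ⟨e, he, d, hd, rfl⟩ := H.exists_eq_pow_mul_unit m hD
    have e1 : ϖ ^ e * d + ϖ ^ m * y = ϖ ^ e * (d + ϖ ^ (m - e) * y) := by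
      rw [mul_add, ← mul_assoc, ← pow_add, Nat.add_sub_cancel' he.le]
    rw [e1, hK _ _ hd, hK]
    exact H.isUnit_add hd (Dvd.dvd.mul_right (dvd_pow_self ϖ (by omega)) _)

variable [Fintype R] {ε η : R} (hε : IsUnit ε) (hη : IsUnit η)
include hε hη

/-- The elements `u` with `u² ≡ η²` modulo `ϖ ^ k` are those congruent to `η` or `-η`. -/
theorem sum_filter_sq {k : ℕ} (hk : 0 < k) (g : R → ℂ) :
    ∑ u ∈ Finset.univ.filter (fun u : R => ϖ ^ k ∣ ε * (η ^ 2 - u ^ 2)), g u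
      = ∑ x ∈ Finset.univ.filter (fun x : R => ϖ ^ k ∣ x), (g (η + x) + g (-η + x)) := by
  have hP : ∀ u : R, ϖ ^ k ∣ ε * (η ^ 2 - u ^ 2) ↔ ϖ ^ k ∣ u - η ∨ ϖ ^ k ∣ u + η := by
    intro u
    have e : ε * (η ^ 2 - u ^ 2) = -(ε * ((u - η) * (u + η))) := by ring
    rw [e, dvd_neg, hε.dvd_mul_left]
    refine ⟨fun h => ?_, fun h => h.elim (fun h => h.mul_right _) (fun h => h.mul_left _)⟩
    rcases H.isUnit_or_dvd (u - η) with h1 | h1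
    · exact Or.inr (h1.dvd_mul_left.1 h)
    · have h2 : IsUnit (u + η) := by
        have := H.isUnit_add (H.isUnit_two.mul hη) h1
        rwa [show 2 * η + (u - η) = u + η by ring] at this
      exact Or.inl (h2.dvd_mul_right.1 h)
  have hdisj : Disjoint (Finset.univ.filter (fun u : R => ϖ ^ k ∣ u - η))
      (Finset.univ.filter (fun u : R => ϖ ^ k ∣ u + η)) := by
    rw [Finset.disjoint_filter]
    intro u _ h1 h2
    refine H.isUnit_iff.1 (H.isUnit_two.mul hη) ((dvd_pow_self ϖ hk.ne').trans ?_)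
    have := dvd_sub h2 h1
    rwa [show u + η - (u - η) = 2 * η by ring] at this
  simp only [hP]
  rw [Finset.filter_or, Finset.sum_union hdisj, Finset.sum_add_distrib]
  congr 1
  · refine Finset.sum_nbij' (fun u => u - η) (fun x => η + x) ?_ ?_ ?_ ?_ ?_ <;> simp
  · refine Finset.sum_nbij' (fun u => u + η) (fun x => -η + x) ?_ ?_ ?_ ?_ ?_ <;> simp

/-- `x ↦ ε (η² - (e + x)²)` permutes `ϖ ^ k R` when `e² = η²`. -/
theorem sum_norm_shift {k : ℕ} (hk : 0 < k) {e : R} (he : e ^ 2 = η ^ 2) (K : R → ℂ) :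
    ∑ x ∈ Finset.univ.filter (fun x : R => ϖ ^ k ∣ x), K (ε * (η ^ 2 - (e + x) ^ 2))
      = ∑ x ∈ Finset.univ.filter (fun x : R => ϖ ^ k ∣ x), K x := by
  have heu : IsUnit e := by
    have := hη.pow 2
    rw [← he] at this
    exact (isUnit_pow_iff two_ne_zero).1 this
  have h := H.bijective_sq_sub heu hk
  obtain ⟨w, hw⟩ := hε.exists_right_inv
  refine Finset.sum_bij (fun x _ => ε * (η ^ 2 - (e + x) ^ 2)) ?_ ?_ ?_ ?_
  · intro x hx
    simp only [Finset.mem_filter, Finset.mem_univ, true_and] at hx ⊢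
    rw [← he, show ε * (e ^ 2 - (e + x) ^ 2) = x * (-ε * (2 * e + x)) by ring]
    exact hx.mul_right _
  · intro x hx y hy hxy
    simp only [Finset.mem_filter, Finset.mem_univ, true_and] at hx hy
    refine congrArg Subtype.val (h.1 (a₁ := ⟨x, hx⟩) (a₂ := ⟨y, hy⟩) (Subtype.ext ?_))
    simp only
    linear_combination -w * hxy + (x * (2 * e + x) - y * (2 * e + y)) * (-hw)
  · intro y hy
    simp only [Finset.mem_filter, Finset.mem_univ, true_and] at hy
    obtain ⟨⟨x, hx⟩, hxy⟩ := h.2 ⟨-w * y, hy.mul_left _⟩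
    have hxy' : x * (2 * e + x) = -w * y := congrArg Subtype.val hxy
    refine ⟨x, by simpa using hx, ?_⟩
    linear_combination -ε * hxy' + y * hw - ε * he
  · intros; rfl

/-- A stationary phase principle: if `f` transforms under translation by `ϖ ^ m R` through a
nontrivial character wherever the weight does not vanish, then only the neighbourhoods of the
points `±η`, where the weight `K (ε (η² - u²))` is not invariant under this translation,
contribute to the sum of `f`. -/
theorem sum_stationary {m : ℕ} {K : R → ℂ} (hK : ∀ D v : R, IsUnit v → K (D * v) = K D)
    (f χ : R → ℂ) (hχ : ∃ x, χ x ≠ 1)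
    (hf : ∀ u x : R,
      (if ϖ ^ (m + 1) ∣ ε * (η ^ 2 - u ^ 2) then K (ϖ ^ m) else K (ε * (η ^ 2 - u ^ 2))) ≠ 0 →
        f (u + ϖ ^ m * x) = f u * χ x)
    (hf1 : ∀ x, ϖ ^ (m + 1) ∣ x → f (η + x) = f η)
    (hf2 : ∀ x, ϖ ^ (m + 1) ∣ x → f (-η + x) = f (-η)) :
    ∑ u : R, K (ε * (η ^ 2 - u ^ 2)) * f u
      = (∑ x ∈ Finset.univ.filter (fun x : R => ϖ ^ (m + 1) ∣ x), (K x - K (ϖ ^ m)))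
        * (f η + f (-η)) := by
  set D : R → R := fun u => ε * (η ^ 2 - u ^ 2) with hD
  set K' : R → ℂ := fun u => if ϖ ^ (m + 1) ∣ D u then K (ϖ ^ m) else K (D u) with hK'
  have hinv : ∀ u x, K' (u + ϖ ^ m * x) = K' u := by
    intro u x
    have e : D (u + ϖ ^ m * x) = D u + ϖ ^ m * (-ε * x * (2 * u + ϖ ^ m * x)) := by
      simp only [hD]; ring
    simp only [hK', e]
    convert H.truncate_add_eq hK m _ _
  -- the truncated weight is invariant, so that its sum against `f` vanishes
  have hzero : ∑ u : R, K' u * f u = 0 := by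
    obtain ⟨x, hx⟩ := hχ
    have h1 : ∑ u : R, K' u * f u = (∑ u : R, K' u * f u) * χ x := by
      conv_lhs => rw [← Equiv.sum_comp (Equiv.addRight (ϖ ^ m * x))]
      rw [Finset.sum_mul]
      refine Finset.sum_congr rfl fun u _ => ?_
      simp only [Equiv.coe_addRight]
      rw [hinv]
      by_cases h : K' u = 0
      · simp [h]
      · rw [hf u x h, mul_assoc]
    have h2 : (∑ u : R, K' u * f u) * (1 - χ x) = 0 := by linear_combination h1
    exact (mul_eq_zero.1 h2).resolve_right (sub_ne_zero.2 hx.symm)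
  have hsplit : ∑ u : R, K (D u) * f u
      = ∑ u ∈ Finset.univ.filter (fun u : R => ϖ ^ (m + 1) ∣ D u),
          (K (D u) - K (ϖ ^ m)) * f u := by
    rw [← sub_zero (∑ u : R, K (D u) * f u), ← hzero, ← Finset.sum_sub_distrib, Finset.sum_filter]
    refine Finset.sum_congr rfl fun u _ => ?_
    simp only [hK']
    split_ifs <;> ring
  rw [hsplit, H.sum_filter_sq hε hη (Nat.succ_pos m), Finset.sum_add_distrib, mul_add]
  congr 1
  · rw [← H.sum_norm_shift hε hη (Nat.succ_pos m) (e := η) rfl (fun x => K x - K (ϖ ^ m)),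
      Finset.sum_mul]
    refine Finset.sum_congr rfl fun x hx => ?_
    rw [hf1 x (by simpa using hx)]
  · rw [← H.sum_norm_shift hε hη (Nat.succ_pos m) (e := -η) (neg_sq η)
      (fun x => K x - K (ϖ ^ m)), Finset.sum_mul]
    refine Finset.sum_congr rfl fun x hx => ?_
    rw [hf2 x (by simpa using hx)]

end IsTruncatedDVR

/-! ### The inertia subgroup and its cosets -/

section Inertia

open scoped Classical

variable {R : Type*} [CommRing R]

theorem mem_congSubgroup_of_eq {ϖ : R} {l : ℕ} {g : GL (Fin 2) R} {X : Matrix (Fin 2) (Fin 2) R}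
    (h : (g : Matrix (Fin 2) (Fin 2) R) = 1 + ϖ ^ l • X) : g ∈ congSubgroup ϖ l := by
  rw [congSubgroup, MonoidHom.mem_ker]
  ext i j
  rw [Matrix.GeneralLinearGroup.map_apply, h]
  simp [Matrix.one_apply]

theorem det_lin (h e a b : R) :
    (a • (1 : Matrix (Fin 2) (Fin 2) R) + b • compMatrix (h ^ 2 - e) (2 * h)).det
      = (a + b * h) ^ 2 - e * b ^ 2 := by
  simp [compMatrix, Matrix.det_fin_two]
  ring

/-- The centralizer of the companion matrix `β` consists of the polynomials in `β`. -/
theorem mem_torus_of_commute {n t : R} {g : GL (Fin 2) R}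
    (h : compMatrix n t * (g : Matrix (Fin 2) (Fin 2) R) = g * compMatrix n t) :
    g ∈ torus n t := by
  refine ⟨g 0 0, g 0 1, ?_⟩
  have h0 := congrFun (congrFun h 0) 0
  have h1 := congrFun (congrFun h 0) 1
  simp [compMatrix, Matrix.mul_apply, Fin.sum_univ_two] at h0 h1
  ext i j
  fin_cases i <;> fin_cases j <;> simp [compMatrix]
  · linear_combination h0
  · linear_combination h1

theorem torus_commute {n t : R} {g : GL (Fin 2) R} (h : g ∈ torus n t) :
    compMatrix n t * (g : Matrix (Fin 2) (Fin 2) R) = g * compMatrix n t := by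
  rw [torus_eq ⟨g, h⟩]; simp [mul_add, add_mul]

theorem commutator_eq (n t : R) (x : Matrix (Fin 2) (Fin 2) R) :
    compMatrix n t * x - x * compMatrix n t =
      !![x 1 0 + n * x 0 1, x 1 1 - x 0 0 - t * x 0 1;
        n * (x 1 1 - x 0 0 - t * x 0 1) + t * (x 1 0 + n * x 0 1),
        -(x 1 0 + n * x 0 1)] := by
  ext i j
  fin_cases i <;> fin_cases j <;>
    simp [compMatrix, Matrix.mul_apply, Fin.sum_univ_two, Matrix.vecMul, dotProduct] <;> ring

/-- The lower triangular matrix with rows `(1, 0)` and `(a, b)`. These matrices represent the right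
cosets of the torus. -/
noncomputable def affineElt (a : R) (b : Rˣ) : GL (Fin 2) R :=
  Matrix.GeneralLinearGroup.mk'' !![1, 0; a, b] (by simp [Matrix.det_fin_two])

theorem coe_affineElt (a : R) (b : Rˣ) :
    (affineElt a b : Matrix (Fin 2) (Fin 2) R) = !![1, 0; a, (b : R)] := rfl

variable [Nontrivial R] {ϖ : R} {r q : ℕ} (H : IsTruncatedDVR ϖ r q)
include H

/-- `T = S K_l` is the centralizer of `β` modulo `ϖ ^ l`. -/
theorem mem_inertia_iff {n t : R} {l : ℕ} (hl : 0 < l) (x : GL (Fin 2) R) :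
    x ∈ inertia n t ϖ l ↔
      ϖ ^ l ∣ x 1 0 + n * x 0 1 ∧ ϖ ^ l ∣ x 1 1 - x 0 0 - t * x 0 1 := by
  constructor
  · intro h
    obtain ⟨s, hs, k, hk, rfl⟩ := Subgroup.mem_sup_of_normal_right.1 h
    obtain ⟨X, hX⟩ := exists_of_mem_congSubgroup hk
    have hk' : (k : Matrix (Fin 2) (Fin 2) R) = 1 + ϖ ^ l • X := by rw [← hX]; abel
    have e : compMatrix n t * ((s * k : GL (Fin 2) R) : Matrix (Fin 2) (Fin 2) R)
        - ((s * k : GL (Fin 2) R) : Matrix (Fin 2) (Fin 2) R) * compMatrix n t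
        = ϖ ^ l • ((s : Matrix (Fin 2) (Fin 2) R) * (compMatrix n t * X - X * compMatrix n t)) := by
      rw [Units.val_mul, ← mul_assoc, torus_commute hs, hk']
      simp only [mul_add, add_mul, mul_sub, mul_one, mul_smul_comm, smul_mul_assoc, smul_sub,
        mul_assoc]
      abel
    rw [commutator_eq] at e
    have h0 := congrFun (congrFun e 0) 0
    have h1 := congrFun (congrFun e 0) 1
    simp only [Matrix.of_apply, Matrix.cons_val', Matrix.cons_val_zero, Matrix.cons_val_one,
      Matrix.smul_apply, smul_eq_mul] at h0 h1
    exact ⟨⟨_, h0⟩, ⟨_, h1⟩⟩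
  · rintro ⟨⟨z, hz⟩, ⟨w, hw⟩⟩
    set s : Matrix (Fin 2) (Fin 2) R := x 0 0 • 1 + x 0 1 • compMatrix n t with hs
    have hx : (x : Matrix (Fin 2) (Fin 2) R) = s + ϖ ^ l • !![0, 0; z, w] := by
      ext i j
      fin_cases i <;> fin_cases j <;> simp [hs, compMatrix]
      · linear_combination hz
      · linear_combination hw
    have hdet : IsUnit s.det := by
      have h1 : IsUnit (x : Matrix (Fin 2) (Fin 2) R).det :=
        (Matrix.isUnit_iff_isUnit_det _).1 x.isUnit
      refine H.isUnit_of_dvd_sub h1 ((dvd_pow_self ϖ hl.ne').trans ?_)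
      rw [hx, Matrix.det_fin_two, Matrix.det_fin_two]
      exact ⟨s 0 0 * w - s 0 1 * z, by simp; ring⟩
    set S : GL (Fin 2) R := Matrix.GeneralLinearGroup.mk'' s hdet with hS
    have hSs : (S : Matrix (Fin 2) (Fin 2) R) = s := rfl
    have hmem : S ∈ torus n t := ⟨x 0 0, x 0 1, rfl⟩
    refine Subgroup.mem_sup_of_normal_right.2 ⟨S, hmem, S⁻¹ * x, ?_, by group⟩
    refine mem_congSubgroup_of_eq
      (X := ((S⁻¹ : GL (Fin 2) R) : Matrix (Fin 2) (Fin 2) R) * !![0, 0; z, w]) ?_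
    rw [Units.val_mul, hx, mul_add, ← hSs, ← Units.val_mul, inv_mul_cancel, mul_smul_comm]
    rfl

section Cosets

variable [Fintype R] {ε : R} (hε : IsUnit ε) (hsq : ¬ IsSquare ε) {η : R} (hη : IsUnit η) (h : R)
include hε hsq hη

/-- A matrix with trace `2 h` and determinant `h² - ε η²` has irreducible reduction modulo `ϖ`, so
its upper right entry is a unit. -/
theorem isUnit_of_trace_det {a b c d : R} (ht : a + d = 2 * h)
    (hd : a * d - b * c = h ^ 2 - ε * η ^ 2) : IsUnit b := by
  rw [H.isUnit_iff]
  rintro ⟨y, rfl⟩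
  have h1 : ϖ ∣ (a - h) ^ 2 - ε * η ^ 2 := ⟨-(y * c), by linear_combination a * ht - hd⟩
  exact H.isUnit_iff.1 hη (H.dvd_of_dvd_norm hε hsq h1).2

/-- Every element of `GL(2, R)` is uniquely the product of an element of the torus and an affine
element. -/
theorem bijective_torus_mul_affine :
    Function.Bijective (fun p : torus (h ^ 2 - ε * η ^ 2) (2 * h) × (R × Rˣ) =>
      (p.1 : GL (Fin 2) R) * affineElt p.2.1 p.2.2) := by
  set n := h ^ 2 - ε * η ^ 2 with hn
  constructor
  · rintro ⟨s, a, b⟩ ⟨s', a', b'⟩ heq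
    have heq1 : (s : GL (Fin 2) R) * affineElt a b = s' * affineElt a' b' := heq
    have h1 : ((s'⁻¹ * s : torus n (2 * h)) : GL (Fin 2) R) * affineElt a b = affineElt a' b' := by
      rw [Subgroup.coe_mul, Subgroup.coe_inv, mul_assoc, heq1, inv_mul_cancel_left]
    have h2 : s'⁻¹ * s = 1 := by
      have h3 := torus_eq (s'⁻¹ * s)
      generalize s'⁻¹ * s = z at h1 h3 ⊢
      have h4 := congrArg (Units.val) h1
      rw [Units.val_mul, coe_affineElt, coe_affineElt] at h4
      have h5 := congrFun (congrFun h4 0) 0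
      have h6 := congrFun (congrFun h4 0) 1
      simp [Matrix.mul_apply, Fin.sum_univ_two] at h5 h6
      rw [h6] at h3 h5
      rw [zero_mul, add_zero] at h5
      rw [h5] at h3
      refine Subtype.ext (Units.ext ?_)
      rw [h3]
      simp
    have h7 : s = s' := (inv_mul_eq_one.1 h2).symm
    rw [h2, Subgroup.coe_one, one_mul] at h1
    have h8 := congrArg (Units.val) h1
    rw [coe_affineElt, coe_affineElt] at h8
    have h9 := congrFun (congrFun h8 1) 0
    have h10 := congrFun (congrFun h8 1) 1
    simp at h9 h10
    rw [h7, h9, Units.ext h10]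
  · intro x
    -- the affine factor is read off from the first row of the conjugate of `β` by `x`
    set B := compMatrix n (2 * h) with hB
    set γ : Matrix (Fin 2) (Fin 2) R := ((x⁻¹ : GL (Fin 2) R) : Matrix (Fin 2) (Fin 2) R) * B
      * (x : Matrix (Fin 2) (Fin 2) R) with hγ
    have hxx : (x : Matrix (Fin 2) (Fin 2) R) * ((x⁻¹ : GL (Fin 2) R) : Matrix (Fin 2) (Fin 2) R)
        = 1 := by rw [← Units.val_mul]; simp
    have hxγ : B * (x : Matrix (Fin 2) (Fin 2) R) = x * γ := by
      rw [hγ, ← mul_assoc, ← mul_assoc, hxx, one_mul]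
    have ht : γ 0 0 + γ 1 1 = 2 * h := by
      rw [← Matrix.trace_fin_two, hγ, Matrix.trace_mul_comm, ← mul_assoc, hxx, one_mul, hB]
      simp [compMatrix, Matrix.trace_fin_two]
    have hd : γ 0 0 * γ 1 1 - γ 0 1 * γ 1 0 = h ^ 2 - ε * η ^ 2 := by
      rw [← Matrix.det_fin_two, hγ, Matrix.det_mul, Matrix.det_mul, mul_right_comm,
        ← Matrix.det_mul, ← Units.val_mul, inv_mul_cancel, hB]
      simp [compMatrix, Matrix.det_fin_two, hn]
    clear_value γ
    obtain ⟨b, hb⟩ := isUnit_of_trace_det H hε hsq hη h ht hd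
    set y := affineElt (γ 0 0) b with hy
    have hyγ : B * (y : Matrix (Fin 2) (Fin 2) R) = y * γ := by
      rw [hy, coe_affineElt, hB, hb]
      ext i j
      fin_cases i <;> fin_cases j <;> simp [compMatrix, Matrix.mul_apply, Fin.sum_univ_two]
      · linear_combination (-γ 0 0) * ht + hd
      · linear_combination (-γ 0 1) * ht
    have hs : x * y⁻¹ ∈ torus n (2 * h) := by
      apply mem_torus_of_commute
      have hyy : (y : Matrix (Fin 2) (Fin 2) R)
          * ((y⁻¹ : GL (Fin 2) R) : Matrix (Fin 2) (Fin 2) R) = 1 := by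
        rw [← Units.val_mul]; simp
      have hyy' : ((y⁻¹ : GL (Fin 2) R) : Matrix (Fin 2) (Fin 2) R)
          * (y : Matrix (Fin 2) (Fin 2) R) = 1 := by
        rw [← Units.val_mul]; simp
      have h1 : γ * ((y⁻¹ : GL (Fin 2) R) : Matrix (Fin 2) (Fin 2) R)
          = ((y⁻¹ : GL (Fin 2) R) : Matrix (Fin 2) (Fin 2) R) * B := by
        calc γ * ((y⁻¹ : GL (Fin 2) R) : Matrix (Fin 2) (Fin 2) R)
            = ((y⁻¹ : GL (Fin 2) R) : Matrix (Fin 2) (Fin 2) R) * (y * γ)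
              * ((y⁻¹ : GL (Fin 2) R) : Matrix (Fin 2) (Fin 2) R) := by
              rw [← mul_assoc, hyy', one_mul]
          _ = _ := by rw [← hyγ, mul_assoc, mul_assoc, hyy, mul_one]
      rw [Units.val_mul, ← mul_assoc, hxγ, mul_assoc, h1, mul_assoc]
    exact ⟨⟨⟨x * y⁻¹, hs⟩, γ 0 0, b⟩, by simp [hy]⟩

/-- Sums of functions that are invariant under left translation by the torus. -/
theorem sum_GL_eq (F : GL (Fin 2) R → ℂ)
    (hF : ∀ s ∈ torus (h ^ 2 - ε * η ^ 2) (2 * h), ∀ x, F (s * x) = F x) :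
    ∑ x, F x = (Nat.card (torus (h ^ 2 - ε * η ^ 2) (2 * h)) : ℂ)
      * ∑ p : R × Rˣ, F (affineElt p.1 p.2) := by
  rw [← (bijective_torus_mul_affine H hε hsq hη h).sum_comp, Fintype.sum_prod_type]
  simp only [hF _ (Subtype.prop _)]
  rw [Finset.sum_const, Finset.card_univ, nsmul_eq_mul, Nat.card_eq_fintype_card]

theorem card_inertia {l : ℕ} (hl : 0 < l) (hr : r = 2 * l) :
    (Nat.card (inertia (h ^ 2 - ε * η ^ 2) (2 * h) ϖ l) : ℂ)
      = Nat.card (torus (h ^ 2 - ε * η ^ 2) (2 * h)) * (q : ℂ) ^ r := by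
  set T := inertia (h ^ 2 - ε * η ^ 2) (2 * h) ϖ l with hT
  have h1 : (Nat.card T : ℂ) = ∑ x : GL (Fin 2) R, if x ∈ T then (1 : ℂ) else 0 := by
    rw [Nat.card_eq_fintype_card, Fintype.card_subtype, Finset.sum_boole]
  rw [h1, sum_GL_eq H hε hsq hη h _ (fun s hs x => by
    rw [T.mul_mem_cancel_left (le_sup_left (a := torus _ _) hs)])]
  congr 1
  have h2 : ∀ p : R × Rˣ, affineElt p.1 p.2 ∈ T ↔ ϖ ^ l ∣ p.1 ∧ ϖ ^ l ∣ (p.2 : R) - 1 := by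
    intro p
    rw [hT, mem_inertia_iff H hl, coe_affineElt]
    simp
  simp only [h2]
  rw [Finset.sum_boole]
  have h3 : (Finset.univ.filter fun p : R × Rˣ => ϖ ^ l ∣ p.1 ∧ ϖ ^ l ∣ (p.2 : R) - 1)
      = (Finset.univ.filter fun x : R => ϖ ^ l ∣ x) ×ˢ
        (Finset.univ.filter fun x : Rˣ => ϖ ^ l ∣ (x : R) - 1) := by
    ext p; simp
  have h4 : (Finset.univ.filter fun x : Rˣ => ϖ ^ l ∣ (x : R) - 1).card
      = (Finset.univ.filter fun x : R => ϖ ^ l ∣ x).card := by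
    refine Finset.card_bij (fun x _ => (x : R) - 1) ?_ ?_ ?_
    · intro x hx; simpa using hx
    · intro x _ y _ hxy
      exact Units.ext (sub_left_injective hxy)
    · intro y hy
      obtain ⟨v, hv⟩ := H.isUnit_add isUnit_one
        ((dvd_pow_self ϖ hl.ne').trans (by simpa using hy : ϖ ^ l ∣ y))
      exact ⟨v, by simpa [hv] using hy, by simp [hv]⟩
  rw [h3, Finset.card_product, h4, H.card_filter_dvd (by omega), ← pow_add]
  rw [show r - l + (r - l) = r by omega]
  simp

/-- An affine element is determined by the corresponding conjugate of `β`, whose first row is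
`(h + a, b)`. These conjugates are the matrices with trace `2 h` and determinant `h² - ε η²`,
that is, the `h + u X + W` with `X = (0, ε; 1, 0)`, with `W = (a, -ε c; c, -a)` anticommuting
with `X`, and with `a² - ε c² = ε (η² - u²)`. -/
theorem sum_affine_eq (F : R × Rˣ → ℂ) (F' : R → R → R → ℂ)
    (hF : ∀ (u a c : R) (b : Rˣ), a ^ 2 - ε * c ^ 2 = ε * (η ^ 2 - u ^ 2) → (b : R) = ε * (u - c) →
      F (h + a, b) = F' u a c) :
    ∑ p, F p = ∑ u : R, ∑ w ∈ Finset.univ.filter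
      (fun w : R × R => w.1 ^ 2 - ε * w.2 ^ 2 = ε * (η ^ 2 - u ^ 2)), F' u w.1 w.2 := by
  rw [Finset.sum_sigma']
  have hunit : ∀ u a c : R, a ^ 2 - ε * c ^ 2 = ε * (η ^ 2 - u ^ 2) → IsUnit (ε * (u - c)) := by
    intro u a c hw
    refine isUnit_of_trace_det H hε hsq hη h (a := h + a) (c := u + c) (d := h - a) (by ring) ?_
    linear_combination -hw
  symm
  refine Finset.sum_bij (fun p hp => (h + p.2.1, (hunit p.1 p.2.1 p.2.2 (by
    simpa using hp)).unit)) ?_ ?_ ?_ ?_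
  · intros; simp
  · rintro ⟨u, a, c⟩ hp ⟨u', a', c'⟩ hp' heq
    simp only [Finset.mem_sigma, Finset.mem_univ, Finset.mem_filter, true_and] at hp hp'
    obtain ⟨h1, h2⟩ := Prod.mk.inj heq
    have h3 := congrArg Units.val h2
    simp only [IsUnit.unit_spec] at h3
    have ha : a = a' := add_left_cancel h1
    subst ha
    have h4 : u + c = u' + c' := by
      refine (hunit u a c hp).mul_left_cancel ?_
      linear_combination hp - hp' - (u' + c') * h3
    have h5 : u - c = u' - c' := hε.mul_left_cancel h3
    have hu : u = u' := H.isUnit_two.mul_left_cancel (by linear_combination h4 + h5)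
    have hc : c = c' := by linear_combination h4 - hu
    subst hu hc
    rfl
  · rintro ⟨a, b⟩ -
    obtain ⟨e, he⟩ := hε.exists_right_inv
    obtain ⟨d, hd⟩ := H.isUnit_two.exists_right_inv
    have hbb := b.mul_inv
    -- `P = u - c` and `Q = u + c`
    set P := e * b with hP
    set Q := (↑b⁻¹ : R) * (ε * η ^ 2 - (a - h) ^ 2) with hQ
    have hPQ : ε * P * Q = ε * η ^ 2 - (a - h) ^ 2 := by
      linear_combination (ε * η ^ 2 - (a - h) ^ 2) * (↑b * ↑b⁻¹ * he + hbb)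
    have hu : (a - h) ^ 2 - ε * (d * (Q - P)) ^ 2 = ε * (η ^ 2 - (d * (P + Q)) ^ 2) := by
      linear_combination hPQ + ε * P * Q * (2 * d + 1) * hd
    refine ⟨⟨d * (P + Q), a - h, d * (Q - P)⟩, by simpa using hu, Prod.ext (by simp)
      (Units.ext ?_)⟩
    simp only [IsUnit.unit_spec]
    linear_combination ε * P * hd + (b : R) * he
  · rintro ⟨u, a, c⟩ hp
    exact (hF u a c _ (by simpa using hp) (by simp)).symm

end Cosets

end Inertia

/-! ### Values of `ν ⊠ ν'` on conjugates -/

section Values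

variable {R : Type*} [CommRing R] {A : Type*} [CommRing A] [Algebra R A] {n t : R} {τ τ' : A}
  (hτ : τ * τ = algebraMap R A t * τ - algebraMap R A n)
  (hτ' : τ' * τ' = algebraMap R A t * τ' - algebraMap R A n)
  (ν ν' : MulChar A ℂ) (ψ : AddChar R ℂ) {ϖ : R} {l : ℕ} (hϖ : ϖ ^ l * ϖ ^ l = 0)
  (hcomp : ∀ x y : R,
      ν (1 + algebraMap R A (ϖ ^ l) * (algebraMap R A x + algebraMap R A y * τ))
        * ν' (1 + algebraMap R A (ϖ ^ l) * (algebraMap R A x + algebraMap R A y * τ'))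
      = ψ (ϖ ^ l * (x * t + y * (t * t - 2 * n))))

/-- The value of `ν ⊠ ν'` on a product of an element of `S` and an element of `K_l`. -/
theorem extendByZero_boxChar_apply (x : GL (Fin 2) R) (a b : R) (Z : Matrix (Fin 2) (Fin 2) R)
    (hdet : IsUnit (a • (1 : Matrix (Fin 2) (Fin 2) R) + b • compMatrix n t).det)
    (hx : (x : Matrix (Fin 2) (Fin 2) R) = (a • 1 + b • compMatrix n t) * (1 + ϖ ^ l • Z)) :
    extendByZero _ (boxChar n t τ τ' hτ hτ' ν ν' ψ ϖ l hϖ hcomp) x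
      = ν (algebraMap R A a + algebraMap R A b * τ) * ν' (algebraMap R A a + algebraMap R A b * τ')
        * ψ (ϖ ^ l * (compMatrix n t * Z).trace) := by
  set S : GL (Fin 2) R := Matrix.GeneralLinearGroup.mk'' _ hdet with hS
  have hSv : (S : Matrix (Fin 2) (Fin 2) R) = a • 1 + b • compMatrix n t := rfl
  have hSm : S ∈ torus n t := ⟨a, b, rfl⟩
  have hk : ((S⁻¹ * x : GL (Fin 2) R) : Matrix (Fin 2) (Fin 2) R) = 1 + ϖ ^ l • Z := by
    rw [Units.val_mul, hx, ← hSv, ← mul_assoc, ← Units.val_mul, inv_mul_cancel, Units.val_one,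
      one_mul]
  have hkm : S⁻¹ * x ∈ congSubgroup ϖ l := mem_congSubgroup_of_eq hk
  have hmem : x ∈ inertia n t ϖ l :=
    Subgroup.mem_sup_of_normal_right.2 ⟨S, hSm, S⁻¹ * x, hkm, by group⟩
  rw [extendByZero_of_mem _ hmem, boxChar, glue_mul (S := torus n t) (K := congSubgroup ϖ l)
    _ _ _ _ ⟨x, hmem⟩ ⟨S, hSm⟩ ⟨S⁻¹ * x, hkm⟩ (by simp)]
  change (ν (algebraMap R A (S 0 0) + algebraMap R A (S 0 1) * τ)
    * ν' (algebraMap R A (S 0 0) + algebraMap R A (S 0 1) * τ'))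
    * ψ (compMatrix n t * (((S⁻¹ * x : GL (Fin 2) R) : Matrix (Fin 2) (Fin 2) R) - 1)).trace = _
  have e0 : S 0 0 = a := by rw [hSv]; simp [compMatrix]
  have e1 : S 0 1 = b := by rw [hSv]; simp [compMatrix]
  rw [e0, e1, hk, add_sub_cancel_left, mul_smul_comm, Matrix.trace_smul, smul_eq_mul]

/-- The value of `ν ⊠ ν'` on a conjugate of `g = (a + b γ) (1 + ϖ ^ l Z)`, where `γ` is the
corresponding conjugate of `β`. -/
theorem extendByZero_boxChar_conj (y g : GL (Fin 2) R) (γ : Matrix (Fin 2) (Fin 2) R)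
    (hy : compMatrix n t * (y : Matrix (Fin 2) (Fin 2) R) = y * γ)
    (a b : R) (Z : Matrix (Fin 2) (Fin 2) R)
    (hdet : IsUnit (a • (1 : Matrix (Fin 2) (Fin 2) R) + b • compMatrix n t).det)
    (hg : (g : Matrix (Fin 2) (Fin 2) R) = (a • 1 + b • γ) * (1 + ϖ ^ l • Z)) :
    extendByZero _ (boxChar n t τ τ' hτ hτ' ν ν' ψ ϖ l hϖ hcomp) (y * g * y⁻¹)
      = ν (algebraMap R A a + algebraMap R A b * τ) * ν' (algebraMap R A a + algebraMap R A b * τ')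
        * ψ (ϖ ^ l * (γ * Z).trace) := by
  set Y : Matrix (Fin 2) (Fin 2) R := Units.val y with hY
  set Y' : Matrix (Fin 2) (Fin 2) R := ((y⁻¹ : GL (Fin 2) R) : Matrix (Fin 2) (Fin 2) R) with hY'
  have h1 : Y * Y' = 1 := by rw [hY, hY', ← Units.val_mul]; simp
  have h2 : Y' * Y = 1 := by rw [hY, hY', ← Units.val_mul]; simp
  have e : (compMatrix n t * (Y * Z * Y')).trace = (γ * Z).trace := by
    rw [← mul_assoc, ← mul_assoc, hy, Matrix.trace_mul_comm, ← mul_assoc, ← mul_assoc, h2, one_mul]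
  rw [← e]
  refine extendByZero_boxChar_apply hτ hτ' ν ν' ψ hϖ hcomp _ a b (Y * Z * Y') hdet ?_
  have h3 : Y * (a • 1 + b • γ) = (a • 1 + b • compMatrix n t) * Y := by
    rw [mul_add, add_mul, mul_smul_comm, mul_smul_comm, ← hy]; simp
  have h4 : Y * (1 + ϖ ^ l • Z) = (1 + ϖ ^ l • (Y * Z * Y')) * Y := by
    rw [mul_add, add_mul, mul_one, one_mul, mul_smul_comm, smul_mul_assoc, mul_assoc (Y * Z), h2,
      mul_one]
  rw [Units.val_mul, Units.val_mul, hg, ← hY, ← hY', ← mul_assoc, h3, mul_assoc _ Y, h4,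
    ← mul_assoc, mul_assoc _ Y, h1, mul_one]

end Values

section Elliptic

variable {R : Type*} [CommRing R]

theorem coe_ellipticElt (ϖ ε : R) (i : ℕ) (α β : R) (h) :
    (ellipticElt ϖ ε i α β h : Matrix (Fin 2) (Fin 2) R)
      = !![α, ϖ ^ i * ε * β; ϖ ^ i * β, α] := rfl

/-- The matrix `h + u X + W`, with `X = (0, ε; 1, 0)` and `W = (a, -ε c; c, -a)`. -/
def conjMatrix (ε h u a c : R) : Matrix (Fin 2) (Fin 2) R := !![h + a, ε * (u - c); u + c, h - a]

/-- The conjugate of `β` by an affine element. -/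
theorem compMatrix_mul_affineElt {ε η h u a c : R}
    (hw : a ^ 2 - ε * c ^ 2 = ε * (η ^ 2 - u ^ 2)) {b : Rˣ} (hb : (b : R) = ε * (u - c)) :
    compMatrix (h ^ 2 - ε * η ^ 2) (2 * h) *
        (affineElt (h + a) b : Matrix (Fin 2) (Fin 2) R)
      = affineElt (h + a) b * conjMatrix ε h u a c := by
  rw [coe_affineElt, hb]
  ext i j
  fin_cases i <;> fin_cases j <;>
    simp [compMatrix, conjMatrix, Matrix.mul_apply, Fin.sum_univ_two]
  · linear_combination -hw
  · ring

variable [Nontrivial R] {ϖ : R} {r q : ℕ} (H : IsTruncatedDVR ϖ r q)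
include H

/-- A conjugate of the elliptic element lies in `T` exactly when the component `W` of the
corresponding conjugate of `β` that anticommutes with `X` vanishes modulo `ϖ ^ (l - i)`. -/
theorem conj_ellipticElt_mem_iff {l : ℕ} (hl : 0 < l) (hlr : l ≤ r) {n t ε : R} (hε : IsUnit ε)
    (i : ℕ) (α : R) {β : R} (hβ : IsUnit β) (hC) {h u a c : R} (y : GL (Fin 2) R)
    (hy : compMatrix n t * (y : Matrix (Fin 2) (Fin 2) R) = y * conjMatrix ε h u a c) :
    y * ellipticElt ϖ ε i α β hC * y⁻¹ ∈ inertia n t ϖ l ↔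
      ϖ ^ (l - i) ∣ a ∧ ϖ ^ (l - i) ∣ c := by
  set γ := conjMatrix ε h u a c with hγ
  set g : Matrix (Fin 2) (Fin 2) R := !![α, ϖ ^ i * ε * β; ϖ ^ i * β, α] with hg
  set Y : Matrix (Fin 2) (Fin 2) R := Units.val y with hY
  set Y' : Matrix (Fin 2) (Fin 2) R := ((y⁻¹ : GL (Fin 2) R) : Matrix (Fin 2) (Fin 2) R) with hY'
  have h1 : Y * Y' = 1 := by rw [hY, hY', ← Units.val_mul]; simp
  have h2 : Y' * Y = 1 := by rw [hY, hY', ← Units.val_mul]; simp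
  have hy' : Y' * compMatrix n t = γ * Y' := by
    calc Y' * compMatrix n t = Y' * (compMatrix n t * Y) * Y' := by
          rw [mul_assoc, mul_assoc, h1, mul_one]
      _ = _ := by rw [hy, ← mul_assoc, h2, one_mul]
  have hcomm : compMatrix n t * (Y * g * Y') - (Y * g * Y') * compMatrix n t
      = Y * (γ * g - g * γ) * Y' := by
    rw [← mul_assoc, ← mul_assoc, hy, mul_assoc (Y * g), hy']
    noncomm_ring
  have hcalc : γ * g - g * γ = (ϖ ^ i * (2 * β)) • !![-(ε * c), ε * a; -a, ε * c] := by
    rw [hγ, hg, conjMatrix]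
    ext i j
    fin_cases i <;> fin_cases j <;> simp <;> ring
  have hx : ((y * ellipticElt ϖ ε i α β hC * y⁻¹ : GL (Fin 2) R) : Matrix (Fin 2) (Fin 2) R)
      = Y * g * Y' := rfl
  have h2β : IsUnit (2 * β) := H.isUnit_two.mul hβ
  rw [mem_inertia_iff H hl, hx]
  rw [commutator_eq] at hcomm
  constructor
  · rintro ⟨⟨z, hz⟩, ⟨w, hw⟩⟩
    -- the commutator is a multiple of `ϖ ^ l`, and so is its conjugate
    have h3 : γ * g - g * γ = ϖ ^ l • (Y' * !![z, w; n * w + t * z, -z] * Y) := by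
      have h4 : Y' * (Y * (γ * g - g * γ) * Y') * Y = γ * g - g * γ := by
        rw [mul_assoc Y, ← mul_assoc Y', h2, one_mul, mul_assoc, h2, mul_one]
      rw [← h4, ← hcomm, ← smul_mul_assoc, ← mul_smul_comm, hz, hw]
      congr 2
      ext i j
      fin_cases i <;> fin_cases j <;> (simp; try ring)
    rw [hcalc] at h3
    have e0 := congrFun (congrFun h3 0) 0
    have e1 := congrFun (congrFun h3 1) 0
    simp only [Matrix.smul_apply, Matrix.of_apply, Matrix.cons_val', Matrix.cons_val_zero,
      Matrix.cons_val_one, smul_eq_mul] at e0 e1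
    constructor
    · have h5 : ϖ ^ l ∣ ϖ ^ i * (2 * β * (-a)) := by rw [← mul_assoc]; exact ⟨_, e1⟩
      have h6 := H.dvd_cancel hlr h5
      rwa [h2β.dvd_mul_left, dvd_neg] at h6
    · have h5 : ϖ ^ l ∣ ϖ ^ i * (2 * β * (-(ε * c))) := by rw [← mul_assoc]; exact ⟨_, e0⟩
      have h6 := H.dvd_cancel hlr h5
      rwa [h2β.dvd_mul_left, dvd_neg, hε.dvd_mul_left] at h6
  · rintro ⟨⟨a', rfl⟩, ⟨c', rfl⟩⟩
    have hp : ϖ ^ l ∣ ϖ ^ i * ϖ ^ (l - i) := by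
      rw [← pow_add]; exact pow_dvd_pow _ (by omega)
    obtain ⟨p, hp⟩ := hp
    have h3 : γ * g - g * γ = ϖ ^ l • ((p * (2 * β)) • !![-(ε * c'), ε * a'; -a', ε * c']) := by
      rw [hcalc]
      ext i j
      fin_cases i <;> fin_cases j <;> simp
      · linear_combination (2 * β * ε * c') * hp
      · linear_combination (2 * β * ε * a') * hp
      · linear_combination (2 * β * a') * hp
      · linear_combination (2 * β * ε * c') * hp
    rw [h3, mul_smul_comm, smul_mul_assoc] at hcomm
    have e0 := congrFun (congrFun hcomm 0) 0
    have e1 := congrFun (congrFun hcomm 0) 1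
    simp only [Matrix.smul_apply (ϖ ^ l), Matrix.of_apply, Matrix.cons_val', Matrix.cons_val_zero,
      Matrix.cons_val_one, smul_eq_mul] at e0 e1
    exact ⟨⟨_, e0⟩, ⟨_, e1⟩⟩

end Elliptic

section EllipticCharacter

variable {R : Type*} [CommRing R] {A : Type*} [CommRing A] [Algebra R A] {ε η h : R} {τ τ' : A}
  (hτ : τ * τ = algebraMap R A (2 * h) * τ - algebraMap R A (h ^ 2 - ε * η ^ 2))
  (hτ' : τ' * τ' = algebraMap R A (2 * h) * τ' - algebraMap R A (h ^ 2 - ε * η ^ 2))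
  (ν ν' : MulChar A ℂ) (ψ : AddChar R ℂ) {ϖ : R} {l : ℕ} (hϖ : ϖ ^ l * ϖ ^ l = 0)
  (hcomp : ∀ x y : R,
      ν (1 + algebraMap R A (ϖ ^ l) * (algebraMap R A x + algebraMap R A y * τ))
        * ν' (1 + algebraMap R A (ϖ ^ l) * (algebraMap R A x + algebraMap R A y * τ'))
      = ψ (ϖ ^ l * (x * (2 * h) + y * (2 * h * (2 * h) - 2 * (h ^ 2 - ε * η ^ 2)))))

/-- The value of `ν ⊠ ν'` on the conjugates of the elliptic element when `i ≥ l`. Then the elliptic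
element is central modulo `ϖ ^ l`. -/
theorem boxChar_conj_ellipticElt_of_le {i : ℕ} (hil : l ≤ i) {α α' β : R} (hα : α * α' = 1) (hC)
    {u a c : R} (y : GL (Fin 2) R)
    (hy : compMatrix (h ^ 2 - ε * η ^ 2) (2 * h) * (y : Matrix (Fin 2) (Fin 2) R)
      = y * conjMatrix ε h u a c) :
    extendByZero _ (boxChar _ _ τ τ' hτ hτ' ν ν' ψ ϖ l hϖ hcomp)
        (y * ellipticElt ϖ ε i α β hC * y⁻¹)
      = ν (algebraMap R A α) * ν' (algebraMap R A α) * ψ (2 * ε * ϖ ^ i * α' * β * u) := by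
  have hpow : ϖ ^ i = ϖ ^ l * ϖ ^ (i - l) := by rw [← pow_add, Nat.add_sub_cancel' hil]
  rw [extendByZero_boxChar_conj hτ hτ' ν ν' ψ hϖ hcomp y _ _ hy α 0
    ((α' * ϖ ^ (i - l) * β) • !![0, ε; 1, 0]) ?_ ?_]
  · simp only [map_zero, zero_mul, add_zero]
    congr 2
    rw [conjMatrix, hpow]
    simp [Matrix.trace_fin_two]
    ring
  · rw [det_lin]
    exact ⟨⟨α ^ 2, α' ^ 2, by rw [← mul_pow, hα, one_pow],
      by rw [mul_comm, ← mul_pow, hα, one_pow]⟩, by simp⟩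
  · rw [coe_ellipticElt, hpow]
    ext j k
    fin_cases j <;> fin_cases k <;> simp
    · linear_combination (-(ϖ ^ l * ϖ ^ (i - l) * ε * β)) * hα
    · linear_combination (-(ϖ ^ l * ϖ ^ (i - l) * β)) * hα

/-- The value of `ν ⊠ ν'` on the conjugates of the elliptic element that lie in `T`, when
`i < l`. -/
theorem boxChar_conj_ellipticElt_of_lt {i : ℕ} (hil : i ≤ l) {α β u v w a c : R} (hu : u * v = 1)
    (hD : (α ^ 2 - ε * (ϖ ^ i * β * v * η) ^ 2) * w = 1) (hC)
    (hw : a ^ 2 - ε * c ^ 2 = ε * (η ^ 2 - u ^ 2)) (ha : ϖ ^ (l - i) ∣ a) (hc : ϖ ^ (l - i) ∣ c)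
    (y : GL (Fin 2) R)
    (hy : compMatrix (h ^ 2 - ε * η ^ 2) (2 * h) * (y : Matrix (Fin 2) (Fin 2) R)
      = y * conjMatrix ε h u a c) :
    extendByZero _ (boxChar _ _ τ τ' hτ hτ' ν ν' ψ ϖ l hϖ hcomp)
        (y * ellipticElt ϖ ε i α β hC * y⁻¹)
      = ν (algebraMap R A (α - ϖ ^ i * β * v * h) + algebraMap R A (ϖ ^ i * β * v) * τ)
        * ν' (algebraMap R A (α - ϖ ^ i * β * v * h) + algebraMap R A (ϖ ^ i * β * v) * τ')
        * ψ (-(2 * ϖ ^ i * β * v * w * (α - ϖ ^ i * β * v * h) * (ε * (η ^ 2 - u ^ 2)))) := by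
  obtain ⟨a', rfl⟩ := ha
  obtain ⟨c', rfl⟩ := hc
  have hpow : ϖ ^ l = ϖ ^ i * ϖ ^ (l - i) := by rw [← pow_add, Nat.add_sub_cancel' hil]
  set p := ϖ ^ (l - i) with hp
  set B := ϖ ^ i * β * v with hB
  have hBu : B * u = ϖ ^ i * β := by linear_combination ϖ ^ i * β * hu
  set γ := conjMatrix ε h u (p * a') (p * c') with hγ
  set W : Matrix (Fin 2) (Fin 2) R := !![a', -(ε * c'); c', -a'] with hW
  -- the second factor is the adjugate of `a + b γ`, and `w` the inverse of its determinant
  set Z := (-(β * v * w)) • (((α - B * h + 2 * h * B) • 1 - B • γ) * W) with hZ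
  have hγγ : γ * γ = (2 * h) • γ - (h ^ 2 - ε * η ^ 2) • 1 := by
    ext j k
    fin_cases j <;> fin_cases k <;> simp [hγ, conjMatrix, Matrix.mul_apply, Fin.sum_univ_two]
    · linear_combination hw
    · ring
    · ring
    · linear_combination hw
  have hadj : ((α - B * h) • (1 : Matrix (Fin 2) (Fin 2) R) + B • γ)
      * ((α - B * h + 2 * h * B) • 1 - B • γ) = (α ^ 2 - ε * (B * η) ^ 2) • 1 := by
    simp only [add_mul, mul_sub, smul_mul_smul_comm, hγγ, one_mul, mul_one, smul_sub, smul_smul]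
    module
  rw [extendByZero_boxChar_conj hτ hτ' ν ν' ψ hϖ hcomp y _ _ hy (α - B * h) B Z ?_ ?_]
  · congr 2
    have h1 : γ * ((α - B * h + 2 * h * B) • 1 - B • γ)
        = (α - B * h) • γ + (B * (h ^ 2 - ε * η ^ 2)) • 1 := by
      simp only [mul_sub, mul_smul_comm, hγγ, mul_one, smul_sub, smul_smul]
      module
    rw [hZ, mul_smul_comm, ← mul_assoc, h1, Matrix.trace_smul, add_mul, Matrix.trace_add,
      smul_mul_assoc, smul_mul_assoc, Matrix.trace_smul, Matrix.trace_smul, one_mul]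
    have h2 : p * (γ * W).trace = 2 * (ε * (η ^ 2 - u ^ 2)) := by
      rw [← hw, hγ, hW, conjMatrix]
      simp [Matrix.trace_fin_two]
      ring
    have h3 : W.trace = 0 := by simp [hW, Matrix.trace_fin_two]
    rw [h3, hpow]
    simp only [smul_eq_mul]
    linear_combination (-(ϖ ^ i * β * v * w * (α - B * h))) * h2
  · rw [det_lin]
    refine IsUnit.of_mul_eq_one w ?_
    linear_combination hD
  · rw [mul_add, mul_one, hZ, mul_smul_comm, mul_smul_comm, ← mul_assoc, hadj, coe_ellipticElt]
    have h1 : ϖ ^ l * (-(β * v * w)) * (α ^ 2 - ε * (B * η) ^ 2) = -(B * p) := by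
      rw [hpow]
      linear_combination (-(B * p)) * hD
    rw [smul_mul_assoc, one_mul, smul_smul, smul_smul, h1, hγ, hW, conjMatrix]
    ext j k
    fin_cases j <;> fin_cases k <;> simp
    · ring
    · linear_combination (-ε) * hBu
    · linear_combination (-1 : R) * hBu
    · ring

end EllipticCharacter

/-! ### The sum over the conjugates of the elliptic element -/

section EllipticSum

variable {R : Type*} [CommRing R] {A : Type*} [CommRing A] [Algebra R A] {ε η h : R} {τ τ' Φ : A}
  (hτ : τ * τ = algebraMap R A (2 * h) * τ - algebraMap R A (h ^ 2 - ε * η ^ 2))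
  (hτ' : τ' * τ' = algebraMap R A (2 * h) * τ' - algebraMap R A (h ^ 2 - ε * η ^ 2))
  (ν ν' : MulChar A ℂ) (ψ : AddChar R ℂ) {ϖ : R} {l : ℕ} (hϖ : ϖ ^ l * ϖ ^ l = 0)
  (hcomp : ∀ x y : R,
      ν (1 + algebraMap R A (ϖ ^ l) * (algebraMap R A x + algebraMap R A y * τ))
        * ν' (1 + algebraMap R A (ϖ ^ l) * (algebraMap R A x + algebraMap R A y * τ'))
      = ψ (ϖ ^ l * (x * (2 * h) + y * (2 * h * (2 * h) - 2 * (h ^ 2 - ε * η ^ 2)))))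
  (hτΦ : τ = algebraMap R A h + algebraMap R A η * Φ)
  (hτΦ' : τ' = algebraMap R A h - algebraMap R A η * Φ)

/-- The character `a + b Φ ↦ ν(a + b Φ) ν'(a - b Φ)`, in the coordinates `a` and `b`. -/
noncomputable def normPairChar (ν ν' : MulChar A ℂ) (Φ : A) (a b : R) : ℂ :=
  ν (algebraMap R A a + algebraMap R A b * Φ) * ν' (algebraMap R A a - algebraMap R A b * Φ)

include hcomp hτΦ hτΦ' in
/-- Multiplying `a + b Φ` by `1 + ϖ ^ l κ Φ` multiplies the value by `ψ (2 ε η ϖ ^ l κ)`. This is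
the compatibility of `ν`, `ν'` and `ψ` on the elements with trace zero. -/
theorem normPairChar_add (hη : IsUnit η) {a b b' κ : R} (hb' : b' = b + a * (ϖ ^ l * κ))
    (hb : b * (ϖ ^ l * κ) = 0) :
    normPairChar ν ν' Φ a b' = normPairChar ν ν' Φ a b * ψ (2 * ε * η * (ϖ ^ l * κ)) := by
  obtain ⟨d, hd⟩ := hη.exists_right_inv
  have h1 := hcomp (-(h * d * κ)) (d * κ)
  have hdA : algebraMap R A η * algebraMap R A d = 1 := by rw [← map_mul, hd, map_one]
  have e1 : (1 : A) + algebraMap R A (ϖ ^ l) * (algebraMap R A (-(h * d * κ))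
      + algebraMap R A (d * κ) * τ) = 1 + algebraMap R A (ϖ ^ l * κ) * Φ := by
    rw [hτΦ]
    simp only [map_mul, map_neg]
    linear_combination algebraMap R A (ϖ ^ l) * algebraMap R A κ * Φ * hdA
  have e2 : (1 : A) + algebraMap R A (ϖ ^ l) * (algebraMap R A (-(h * d * κ))
      + algebraMap R A (d * κ) * τ') = 1 - algebraMap R A (ϖ ^ l * κ) * Φ := by
    rw [hτΦ']
    simp only [map_mul, map_neg]
    linear_combination (-(algebraMap R A (ϖ ^ l) * algebraMap R A κ * Φ)) * hdA
  have e3 : ϖ ^ l * (-(h * d * κ) * (2 * h)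
      + d * κ * (2 * h * (2 * h) - 2 * (h ^ 2 - ε * η ^ 2))) = 2 * ε * η * (ϖ ^ l * κ) := by
    linear_combination (2 * ε * η * ϖ ^ l * κ) * hd
  rw [e1, e2, e3] at h1
  have hbA : algebraMap R A b * algebraMap R A (ϖ ^ l * κ) = 0 := by rw [← map_mul, hb, map_zero]
  have hb'A : algebraMap R A b'
      = algebraMap R A b + algebraMap R A a * algebraMap R A (ϖ ^ l * κ) := by
    rw [hb', map_add, map_mul (algebraMap R A) a]
  rw [← h1, normPairChar, normPairChar, mul_mul_mul_comm, ← map_mul, ← map_mul, hb'A]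
  congr 2
  · linear_combination (-Φ ^ 2) * hbA
  · linear_combination (-Φ ^ 2) * hbA

variable [Nontrivial R] {r q : ℕ} (H : IsTruncatedDVR ϖ r q) [Fintype R]
  (hε : IsUnit ε) (hsq : ¬ IsSquare ε) (hη : IsUnit η)

include H hε hsq hη in
open scoped Classical in
/-- The sum over the conjugates of the elliptic element, as a sum over the component along `X` of
the corresponding conjugates of `β`. -/
theorem sum_conj_ellipticElt (hl : 0 < l) (hr : r = 2 * l) {i : ℕ} {α β : R} (hβ : IsUnit β) (hC)
    (f : R → ℂ)
    (hf : ∀ (u a c : R) (y : GL (Fin 2) R), a ^ 2 - ε * c ^ 2 = ε * (η ^ 2 - u ^ 2) →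
      ϖ ^ (l - i) ∣ a → ϖ ^ (l - i) ∣ c →
      compMatrix (h ^ 2 - ε * η ^ 2) (2 * h) * (y : Matrix (Fin 2) (Fin 2) R)
        = y * conjMatrix ε h u a c →
      extendByZero _ (boxChar _ _ τ τ' hτ hτ' ν ν' ψ ϖ l hϖ hcomp)
        (y * ellipticElt ϖ ε i α β hC * y⁻¹) = f u) :
    ∑ x, extendByZero _ (boxChar _ _ τ τ' hτ hτ' ν ν' ψ ϖ l hϖ hcomp)
        (x * ellipticElt ϖ ε i α β hC * x⁻¹)
      = Nat.card (torus (h ^ 2 - ε * η ^ 2) (2 * h))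
        * ∑ u, IsTruncatedDVR.restrictedCount ϖ ε (l - i) (ε * (η ^ 2 - u ^ 2)) * f u := by
  set χ := boxChar _ _ τ τ' hτ hτ' ν ν' ψ ϖ l hϖ hcomp with hχ
  rw [sum_GL_eq H hε hsq hη h (fun x => extendByZero _ χ (x * ellipticElt ϖ ε i α β hC * x⁻¹))
    (fun s hs x => by
      have hs' : s ∈ inertia (h ^ 2 - ε * η ^ 2) (2 * h) ϖ l :=
        le_sup_left (a := torus _ _) hs
      rw [← extendByZero_conj _ χ ⟨s, hs'⟩ (x * ellipticElt ϖ ε i α β hC * x⁻¹)]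
      simp [mul_assoc])]
  congr 1
  rw [sum_affine_eq H hε hsq hη h _
    (fun u a c => if ϖ ^ (l - i) ∣ a ∧ ϖ ^ (l - i) ∣ c then f u else 0) ?_]
  · refine Finset.sum_congr rfl fun u _ => ?_
    rw [H.restrictedCount_eq hε hsq (by omega), ← Finset.sum_filter, Finset.sum_const,
      nsmul_eq_mul, Finset.filter_filter]
  · intro u a c b hw hb
    have hy := compMatrix_mul_affineElt (h := h) hw hb
    have hmem := conj_ellipticElt_mem_iff H hl (by omega) hε i α hβ hC _ hy
    split_ifs with hac
    · exact hf u a c _ hw hac.1 hac.2 hy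
    · exact extendByZero_of_notMem _ fun h' => hac (hmem.1 h')

omit [Fintype R] in
include H hε hη in
theorem isUnit_of_dvd_norm_sub {u : R} {k : ℕ} (hk : 0 < k)
    (hu : ϖ ^ k ∣ ε * (η ^ 2 - u ^ 2)) : IsUnit u := by
  rw [hε.dvd_mul_left] at hu
  exact (isUnit_pow_iff two_ne_zero).1
    (H.isUnit_of_dvd_sub (hη.pow 2) ((dvd_pow_self ϖ hk.ne').trans hu))

omit [Fintype R] in
include H hε hη in
/-- Near `±η`, the determinant of the factor in `S` of a conjugate of the elliptic element is
congruent modulo `ϖ` to the determinant of the elliptic element. -/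
theorem isUnit_denominator {i : ℕ} {α β : R} (hC : IsUnit (α ^ 2 - ε * β ^ 2 * ϖ ^ (2 * i)))
    {u : R} {k : ℕ} (hk : 0 < k) (hu : ϖ ^ k ∣ ε * (η ^ 2 - u ^ 2)) :
    IsUnit (α ^ 2 - ε * (ϖ ^ i * β * Ring.inverse u * η) ^ 2) := by
  have hv := Ring.mul_inverse_cancel u (isUnit_of_dvd_norm_sub H hε hη hk hu)
  set v := Ring.inverse u
  obtain ⟨z, hz⟩ := (dvd_pow_self ϖ hk.ne').trans hu
  refine H.isUnit_of_dvd_sub hC ⟨z * (ϖ ^ i * β * v) ^ 2, ?_⟩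
  linear_combination (ϖ ^ i * β * v) ^ 2 * hz + ε * (ϖ ^ i * β) ^ 2 * (u * v + 1) * hv

/-- For `i < l`, the value of `ν ⊠ ν'` on a conjugate of the elliptic element that lies in `T`, as a
function of the component `u` along `X` of the corresponding conjugate of `β`. In that case `u`
and the second inverted element are units. -/
noncomputable def stationaryValue (ν ν' : MulChar A ℂ) (ψ : AddChar R ℂ) (ϖ ε η h : R) (Φ : A)
    (i : ℕ) (α β u : R) : ℂ :=
  normPairChar ν ν' Φ α (ϖ ^ i * β * Ring.inverse u * η)
    * ψ (-(2 * ϖ ^ i * β * Ring.inverse u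
      * Ring.inverse (α ^ 2 - ε * (ϖ ^ i * β * Ring.inverse u * η) ^ 2)
      * (α - ϖ ^ i * β * Ring.inverse u * h) * (ε * (η ^ 2 - u ^ 2))))

omit [Nontrivial R] [Fintype R] in
theorem stationaryValue_self {i : ℕ} {α β e : R} (he : e ^ 2 = η ^ 2) {s : R} (hs : s * e = η)
    (hηu : IsUnit e) :
    stationaryValue ν ν' ψ ϖ ε η h Φ i α β e = normPairChar ν ν' Φ α (ϖ ^ i * β * s) := by
  have hv := Ring.mul_inverse_cancel e hηu
  rw [stationaryValue, he, sub_self, mul_zero, mul_zero, neg_zero, AddChar.map_zero_eq_one,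
    mul_one, mul_assoc _ _ η, ← hs]
  congr 2
  linear_combination s * hv

omit [Fintype R] in
include H hε hη hcomp hτΦ hτΦ' in
/-- Under translation by `ϖ ^ (r - 1 - i) R` near the points `±η`, the function `stationaryValue`
transforms through a nontrivial character: both of its factors are expanded to first order, and the
contributions that depend on `u` cancel, because `u² ≡ η²` modulo `ϖ`. -/
theorem stationaryValue_add {i m : ℕ} (hl : 0 < l) (hr : r = 2 * l) (hi : 0 < i) (hil : i < l)
    (hm : m + 1 + i = r) {α α' β : R} (hα : α * α' = 1)
    (hC : IsUnit (α ^ 2 - ε * β ^ 2 * ϖ ^ (2 * i))) {u : R}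
    (hu : ϖ ^ (2 * (l - i)) ∣ ε * (η ^ 2 - u ^ 2)) (x : R) :
    stationaryValue ν ν' ψ ϖ ε η h Φ i α β (u + ϖ ^ m * x)
      = stationaryValue ν ν' ψ ϖ ε η h Φ i α β u
        * ψ (ϖ ^ (r - 1) * (2 * ε * α' * β * x)) := by
  have hk : 0 < 2 * (l - i) := by omega
  have huu := isUnit_of_dvd_norm_sub H hε hη hk hu
  have huu' : IsUnit (u + ϖ ^ m * x) :=
    H.isUnit_add huu (Dvd.dvd.mul_right (dvd_pow_self ϖ (by omega)) _)
  have hv := Ring.mul_inverse_cancel u huu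
  have hv' := Ring.mul_inverse_cancel _ huu'
  have hDu := isUnit_denominator H hε hη hC hk hu
  have hw := Ring.mul_inverse_cancel _ hDu
  obtain ⟨z, hz⟩ := (dvd_pow_self ϖ hk.ne').trans hu
  set P := ϖ ^ (r - 1) with hP
  have hPϖ : P * ϖ = 0 := by rw [hP, ← pow_succ, Nat.sub_add_cancel (by omega), H.pow_eq_zero]
  have hPi : P * ϖ ^ i = 0 := by
    rw [← Nat.sub_add_cancel hi, pow_add, pow_one, mul_comm (ϖ ^ (i - 1)), ← mul_assoc, hPϖ,
      zero_mul]
  have hPm : P * ϖ ^ m = 0 := by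
    rw [← Nat.sub_add_cancel (show 1 ≤ m by omega), pow_add, pow_one, mul_comm (ϖ ^ (m - 1)),
      ← mul_assoc, hPϖ, zero_mul]
  have him : ϖ ^ i * ϖ ^ m = P := by rw [hP, ← pow_add]; congr 1; omega
  have hPl : P = ϖ ^ l * ϖ ^ (r - 1 - l) := by rw [hP, ← pow_add]; congr 1; omega
  set v := Ring.inverse u with hvdef
  set v' := Ring.inverse (u + ϖ ^ m * x) with hvdef'
  have hvv : v' = v - ϖ ^ m * x * v * v' := by linear_combination v * hv' - v' * hv
  -- to first order, only `ϖ ^ i v` and `η² - u²` change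
  have hiv : ϖ ^ i * v' = ϖ ^ i * v - P * (x * v * v') := by
    linear_combination ϖ ^ i * hvv - x * v * v' * him
  have hPv : P * v' = P * v := by linear_combination P * hvv - x * v * v' * hPm
  have hD : α ^ 2 - ε * (ϖ ^ i * β * v' * η) ^ 2 = α ^ 2 - ε * (ϖ ^ i * β * v * η) ^ 2 := by
    linear_combination (-ε * (β * η) ^ 2 * (ϖ ^ i * v' + ϖ ^ i * v)) * hiv
      + (ε * (β * η) ^ 2 * (v' + v) * (x * v * v')) * hPi
  set w := Ring.inverse (α ^ 2 - ε * (ϖ ^ i * β * v * η) ^ 2) with hwdef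
  have hPη : P * η ^ 2 = P * u ^ 2 := by
    refine hε.mul_left_cancel ?_
    linear_combination P * hz + z * hPϖ
  have hPw : P * (w * α) = P * α' := by
    linear_combination (-(P * w * α)) * hα + α' * P * hw
      + α' * w * ε * (β * v * η) ^ 2 * ϖ ^ i * hPi
  clear_value P v v' w
  have t1 : P * (η ^ 2 * v * v') = P := by
    linear_combination v * v' * hPη + u ^ 2 * v * hPv + P * (u * v + 1) * hv
  have t2 : ϖ ^ i * v' * (α - ϖ ^ i * β * v' * h)
      = ϖ ^ i * v * (α - ϖ ^ i * β * v * h) - P * (x * v * v' * α) := by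
    linear_combination (α - β * h * (ϖ ^ i * v + ϖ ^ i * v')) * hiv
      + x * v * v' * β * h * (v + v') * hPi
  have t3 : P * (ε * (η ^ 2 - (u + ϖ ^ m * x) ^ 2)) = 0 := by
    linear_combination P * hz + z * hPϖ - ε * (2 * u * x + ϖ ^ m * x ^ 2) * hPm
  have t4 : ϖ ^ i * v * (α - ϖ ^ i * β * v * h) * (ε * (η ^ 2 - (u + ϖ ^ m * x) ^ 2))
      = ϖ ^ i * v * (α - ϖ ^ i * β * v * h) * (ε * (η ^ 2 - u ^ 2)) - 2 * ε * P * (α * x) := by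
    linear_combination
      (-ε * v * (α - ϖ ^ i * β * v * h) * (2 * u * x + ϖ ^ m * x ^ 2)) * him
      + ε * v * β * v * h * (2 * u * x + ϖ ^ m * x ^ 2) * hPi - ε * v * α * x ^ 2 * hPm
      - 2 * ε * P * α * x * hv
  have key : ψ (2 * ε * η * (ϖ ^ l * -(ϖ ^ (r - 1 - l) * β * η * x * v * v' * α')))
      * ψ (-(2 * ϖ ^ i * β * v' * w * (α - ϖ ^ i * β * v' * h)
        * (ε * (η ^ 2 - (u + ϖ ^ m * x) ^ 2))))
      = ψ (-(2 * ϖ ^ i * β * v * w * (α - ϖ ^ i * β * v * h) * (ε * (η ^ 2 - u ^ 2))))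
        * ψ (P * (2 * ε * α' * β * x)) := by
    rw [← AddChar.map_add_eq_mul, ← AddChar.map_add_eq_mul]
    congr 1
    linear_combination (2 * ε * η ^ 2 * β * x * v * v' * α') * hPl
      - 2 * ε * β * x * α' * t1
      - 2 * β * w * (ε * (η ^ 2 - (u + ϖ ^ m * x) ^ 2)) * t2
      + 2 * β * w * (x * v * v') * α * t3 - 2 * β * w * t4 + 4 * β * ε * x * hPw
  rw [stationaryValue, stationaryValue, ← hvdef, ← hvdef', hD, ← hwdef,
    normPairChar_add ν ν' ψ hcomp hτΦ hτΦ' hη (a := α) (b := ϖ ^ i * β * v * η)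
    (κ := -(ϖ ^ (r - 1 - l) * β * η * x * v * v' * α')) ?_ ?_]
  · linear_combination normPairChar ν ν' Φ α (ϖ ^ i * β * v * η) * key
  · linear_combination β * η * hiv - β * η * x * v * v' * hPl
      + β * η * x * v * v' * ϖ ^ l * ϖ ^ (r - 1 - l) * hα
  · linear_combination (ϖ ^ i * β * v * η * (β * η * x * v * v') * α') * hPl
      - β * v * η * (β * η * x * v * v') * α' * hPi

end EllipticSum

section CharacterFormula

variable {R : Type*} [CommRing R] {A : Type*} [CommRing A] [Algebra R A] {ε η h : R} {τ τ' Φ : A}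
  (hτ : τ * τ = algebraMap R A (2 * h) * τ - algebraMap R A (h ^ 2 - ε * η ^ 2))
  (hτ' : τ' * τ' = algebraMap R A (2 * h) * τ' - algebraMap R A (h ^ 2 - ε * η ^ 2))
  (ν ν' : MulChar A ℂ) (ψ : AddChar R ℂ) {ϖ : R} {l : ℕ} (hϖ : ϖ ^ l * ϖ ^ l = 0)
  (hcomp : ∀ x y : R,
      ν (1 + algebraMap R A (ϖ ^ l) * (algebraMap R A x + algebraMap R A y * τ))
        * ν' (1 + algebraMap R A (ϖ ^ l) * (algebraMap R A x + algebraMap R A y * τ'))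
      = ψ (ϖ ^ l * (x * (2 * h) + y * (2 * h * (2 * h) - 2 * (h ^ 2 - ε * η ^ 2)))))
  (hτΦ : τ = algebraMap R A h + algebraMap R A η * Φ)
  (hτΦ' : τ' = algebraMap R A h - algebraMap R A η * Φ)
  [Nontrivial R] {r q : ℕ} (H : IsTruncatedDVR ϖ r q) [Fintype R]
  (hε : IsUnit ε) (hsq : ¬ IsSquare ε) (hη : IsUnit η)
  (hψ : ∃ x, ψ (ϖ ^ (r - 1) * x) ≠ 1)

include H hε hsq hη hψ in
/-- Evaluation of the weighted sum of a function that transforms under translation by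
`ϖ ^ (r - 1 - i) R` through a nontrivial character on the support of the weight. -/
theorem sum_restrictedCount_mul (hl : 0 < l) (hr : r = 2 * l) {i m : ℕ} (hm : m + 1 + i = r)
    (f : R → ℂ)
    (hf : 0 < i → ∃ c : R, IsUnit c ∧ ∀ u x : R, ϖ ^ (2 * (l - i)) ∣ ε * (η ^ 2 - u ^ 2) →
      f (u + ϖ ^ m * x) = f u * ψ (ϖ ^ (r - 1) * (c * x))) :
    ∑ u, IsTruncatedDVR.restrictedCount ϖ ε (l - i) (ε * (η ^ 2 - u ^ 2)) * f u
      = (q : ℂ) ^ r * (-(q : ℂ)) ^ i * (f η + f (-η)) := by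
  have hK : ∀ D v : R, IsUnit v → IsTruncatedDVR.restrictedCount ϖ ε (l - i) (D * v)
      = IsTruncatedDVR.restrictedCount ϖ ε (l - i) D :=
    fun D v hv => H.restrictedCount_mul_unit hε _ D hv
  rw [← H.sum_restrictedCount_sub hε hsq hl hr hm]
  rcases Nat.eq_zero_or_pos i with rfl | hi
  · have hmr : ϖ ^ (m + 1) = 0 := by rw [show m + 1 = r by omega, H.pow_eq_zero]
    refine H.sum_stationary hε hη hK f _ hψ ?_ ?_ ?_
    · -- the weight, made constant near `±η`, vanishes
      intro u x hne
      exfalso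
      apply hne
      split_ifs with hu
      · rw [Nat.sub_zero, show m = r - 1 by omega, H.restrictedCount_top hl hr]
      · rw [IsTruncatedDVR.restrictedCount, if_neg]
        rwa [Nat.sub_zero, ← hr, show r = m + 1 by omega]
    all_goals
      intro x hx
      rw [hmr, zero_dvd_iff] at hx
      rw [hx, add_zero]
  · obtain ⟨c, hc, hf⟩ := hf hi
    have hnear : ∀ e : R, e ^ 2 = η ^ 2 → ∀ x, ϖ ^ (m + 1) ∣ x → f (e + x) = f e := by
      rintro e he _ ⟨y, rfl⟩
      have h0 : ϖ ^ (r - 1) * (c * (ϖ * y)) = 0 := by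
        have h1 : ϖ ^ (r - 1) * ϖ = 0 := by
          rw [← pow_succ, Nat.sub_add_cancel (by omega), H.pow_eq_zero]
        linear_combination c * y * h1
      rw [pow_succ, mul_assoc, hf e (ϖ * y) (by rw [he, sub_self, mul_zero]; exact dvd_zero _), h0,
        AddChar.map_zero_eq_one, mul_one]
    refine H.sum_stationary hε hη hK f (fun x => ψ (ϖ ^ (r - 1) * (c * x))) ?_ ?_
      (hnear η rfl) (hnear (-η) (neg_sq η))
    · obtain ⟨x, hx⟩ := hψ
      obtain ⟨d, hd⟩ := hc.exists_right_inv
      refine ⟨d * x, ?_⟩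
      rwa [← mul_assoc c, hd, one_mul]
    · intro u x hne
      refine hf u x ?_
      by_contra hu
      apply hne
      rw [if_neg fun h' => hu ((pow_dvd_pow ϖ (by omega)).trans h'),
        IsTruncatedDVR.restrictedCount, if_neg hu]

include H hε hsq hη hψ in
/-- The character formula, given the values of `ν ⊠ ν'` on the conjugates of the elliptic
element. -/
theorem character_ellipticElt_of_value (hl : 0 < l) (hr : r = 2 * l) {i m : ℕ}
    (hm : m + 1 + i = r) {α β : R} (hβ : IsUnit β) (hC) (f : R → ℂ)
    (hval : ∀ (u a c : R) (y : GL (Fin 2) R), a ^ 2 - ε * c ^ 2 = ε * (η ^ 2 - u ^ 2) →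
      ϖ ^ (l - i) ∣ a → ϖ ^ (l - i) ∣ c →
      compMatrix (h ^ 2 - ε * η ^ 2) (2 * h) * (y : Matrix (Fin 2) (Fin 2) R)
        = y * conjMatrix ε h u a c →
      extendByZero _ (boxChar _ _ τ τ' hτ hτ' ν ν' ψ ϖ l hϖ hcomp)
        (y * ellipticElt ϖ ε i α β hC * y⁻¹) = f u)
    (hf : 0 < i → ∃ c : R, IsUnit c ∧ ∀ u x : R, ϖ ^ (2 * (l - i)) ∣ ε * (η ^ 2 - u ^ 2) →
      f (u + ϖ ^ m * x) = f u * ψ (ϖ ^ (r - 1) * (c * x))) :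
    (Representation.ind (inertia (h ^ 2 - ε * η ^ 2) (2 * h) ϖ l).subtype
      (oneDim (boxChar _ _ τ τ' hτ hτ' ν ν' ψ ϖ l hϖ hcomp))).character
        (ellipticElt ϖ ε i α β hC) = (-(q : ℂ)) ^ i * (f η + f (-η)) := by
  classical
  have h1 := card_mul_character_ind (inertia (h ^ 2 - ε * η ^ 2) (2 * h) ϖ l)
    (boxChar _ _ τ τ' hτ hτ' ν ν' ψ ϖ l hϖ hcomp) (ellipticElt ϖ ε i α β hC)
  rw [card_inertia H hε hsq hη h hl hr,
    sum_conj_ellipticElt hτ hτ' ν ν' ψ hϖ hcomp H hε hsq hη hl hr hβ hC f hval,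
    sum_restrictedCount_mul ψ H hε hsq hη hψ hl hr hm f hf, mul_assoc] at h1
  have hS : (Nat.card (torus (h ^ 2 - ε * η ^ 2) (2 * h)) : ℂ) ≠ 0 := by
    exact_mod_cast Nat.card_pos.ne'
  have hq : (q : ℂ) ^ r ≠ 0 := pow_ne_zero _ (by exact_mod_cast (zero_lt_one.trans H.one_lt).ne')
  have h2 := mul_left_cancel₀ hS h1
  rw [mul_assoc] at h2
  exact mul_left_cancel₀ hq h2

include H hε hsq hη hψ hτΦ hτΦ' in
/-- The character formula over a ring with the properties of `𝒪 / ϖ ^ r 𝒪`, with `τ = h + η Φ`. -/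
theorem character_ellipticElt (hl : 0 < l) (hr : r = 2 * l) {i : ℕ} (hi : i ≤ r - 1) {α β : R}
    (hβ : IsUnit β) (hC : IsUnit (α ^ 2 - ε * β ^ 2 * ϖ ^ (2 * i))) :
    (Representation.ind (inertia (h ^ 2 - ε * η ^ 2) (2 * h) ϖ l).subtype
      (oneDim (boxChar _ _ τ τ' hτ hτ' ν ν' ψ ϖ l hϖ hcomp))).character
        (ellipticElt ϖ ε i α β hC)
      = (-(q : ℂ)) ^ i * (normPairChar ν ν' Φ α (ϖ ^ i * β)
        + normPairChar ν ν' Φ α (-(ϖ ^ i * β))) := by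
  obtain ⟨m, hm⟩ : ∃ m, m + 1 + i = r := ⟨r - 1 - i, by omega⟩
  have hα : 0 < i → ∃ α', α * α' = 1 := fun hi0 => by
    have h1 : IsUnit (α ^ 2) := H.isUnit_of_dvd_sub hC
      ((dvd_pow_self ϖ (show 2 * i ≠ 0 by omega)).trans ⟨-(ε * β ^ 2), by ring⟩)
    exact ((isUnit_pow_iff two_ne_zero).1 h1).exists_right_inv
  rcases lt_or_ge i l with hil | hil
  · have hval := character_ellipticElt_of_value hτ hτ' ν ν' ψ hϖ hcomp H hε hsq hη hψ hl hr hm hβ hC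
      (stationaryValue ν ν' ψ ϖ ε η h Φ i α β) ?_ ?_
    · rw [hval, stationaryValue_self ν ν' ψ (e := η) (s := 1) rfl (one_mul η) hη,
        stationaryValue_self ν ν' ψ (e := -η) (s := -1) (neg_sq η) (by ring) hη.neg, mul_one,
        mul_neg_one]
    · intro u a c y hw ha hc hy
      have hu : ϖ ^ (2 * (l - i)) ∣ ε * (η ^ 2 - u ^ 2) := by
        rw [← hw, mul_comm 2, pow_mul]
        exact dvd_sub (pow_dvd_pow_of_dvd ha 2) ((pow_dvd_pow_of_dvd hc 2).mul_left _)
      have hk : 0 < 2 * (l - i) := by omega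
      rw [boxChar_conj_ellipticElt_of_lt hτ hτ' ν ν' ψ hϖ hcomp hil.le
        (Ring.mul_inverse_cancel u (isUnit_of_dvd_norm_sub H hε hη hk hu))
        (Ring.mul_inverse_cancel _ (isUnit_denominator H hε hη hC hk hu)) hC hw ha hc y hy,
        stationaryValue, normPairChar, hτΦ, hτΦ']
      congr 3
      · simp only [map_sub, map_mul]
        ring_nf
      · simp only [map_sub, map_mul]
        ring_nf
    · intro hi0
      obtain ⟨α', hα'⟩ := hα hi0
      have hα'u : IsUnit α' := IsUnit.of_mul_eq_one α (by rw [mul_comm]; exact hα')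
      exact ⟨2 * ε * α' * β, ((H.isUnit_two.mul hε).mul hα'u).mul hβ, fun u x hu =>
        stationaryValue_add ν ν' ψ hcomp hτΦ hτΦ' H hε hη hl hr hi0 hil hm hα' hC hu x⟩
  · obtain ⟨α', hα'⟩ := hα (by omega)
    have hα'u : IsUnit α' := IsUnit.of_mul_eq_one α (by rw [mul_comm]; exact hα')
    have hpow : ϖ ^ i = ϖ ^ l * ϖ ^ (i - l) := by rw [← pow_add, Nat.add_sub_cancel' hil]
    have hpair : ∀ s : R, normPairChar ν ν' Φ α (s * (ϖ ^ i * β))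
        = normPairChar ν ν' Φ α 0 * ψ (2 * ε * ϖ ^ i * α' * β * (s * η)) := fun s => by
      rw [normPairChar_add ν ν' ψ hcomp hτΦ hτΦ' hη (a := α) (b := 0)
        (κ := s * ϖ ^ (i - l) * α' * β) (by
          rw [hpow]; linear_combination (-(s * ϖ ^ l * ϖ ^ (i - l) * β)) * hα') (zero_mul _), hpow]
      ring_nf
    rw [character_ellipticElt_of_value hτ hτ' ν ν' ψ hϖ hcomp H hε hsq hη hψ hl hr hm hβ hC
      (fun u => normPairChar ν ν' Φ α 0 * ψ (2 * ε * ϖ ^ i * α' * β * u)) ?_ ?_]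
    · have h1 := hpair 1
      have h2 := hpair (-1)
      simp only [one_mul, neg_mul] at h1 h2
      rw [h1, h2]
    · intro u a c y _ _ _ hy
      rw [boxChar_conj_ellipticElt_of_le hτ hτ' ν ν' ψ hϖ hcomp hil hα' hC y hy, normPairChar]
      simp
    · intro _
      refine ⟨2 * ε * α' * β, ((H.isUnit_two.mul hε).mul hα'u).mul hβ, fun u x _ => ?_⟩
      rw [mul_assoc (normPairChar _ _ _ _ _) (ψ _), ← AddChar.map_add_eq_mul]
      congr 2
      rw [show r - 1 = i + m by omega, pow_add]
      ring

end CharacterFormula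

/-! ### Additive characters and the rings `𝒪_r` and `𝒪_r^E` -/

section Duality

variable {R : Type*} [CommRing R] {ϖ : R} {r q : ℕ} (H : IsTruncatedDVR ϖ r q)
include H

/-- A character that is nontrivial on `ϖ ^ (r - 1) R` is primitive. -/
theorem isPrimitive_of_nontrivial (hr : 0 < r) {ψ : AddChar R ℂ}
    (hψ : ∃ x, ψ (ϖ ^ (r - 1) * x) ≠ 1) : ψ.IsPrimitive := by
  intro a ha h
  obtain ⟨e, he, d, hd, rfl⟩ := H.exists_eq_pow_mul_unit r (x := a) (by
    rwa [H.pow_eq_zero, zero_dvd_iff])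
  obtain ⟨d', hd'⟩ := hd.exists_right_inv
  obtain ⟨x, hx⟩ := hψ
  apply hx
  have h1 := DFunLike.congr_fun h (ϖ ^ (r - 1 - e) * d' * x)
  rw [AddChar.mulShift_apply, AddChar.one_apply] at h1
  rw [← h1]
  congr 1
  rw [show r - 1 = e + (r - 1 - e) by omega, pow_add, show e + (r - 1 - e) - e = r - 1 - e by omega]
  linear_combination (-(ϖ ^ e * ϖ ^ (r - 1 - e) * x)) * hd'

/-- A character of `R` that is trivial on `ϖ ^ l R`, where `r = 2 l`, has the form
`x ↦ ψ (ϖ ^ l a x)`. -/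
theorem exists_eq_mulShift [Finite R] {l : ℕ} (hl : 0 < l) (hr : r = 2 * l) {ψ : AddChar R ℂ}
    (hψ : ∃ x, ψ (ϖ ^ (r - 1) * x) ≠ 1) (χ : AddChar R ℂ) (hχ : ∀ x, χ (ϖ ^ l * x) = 1) :
    ∃ a, ∀ x, χ x = ψ (ϖ ^ l * (a * x)) := by
  have hprim := isPrimitive_of_nontrivial H (by omega) hψ
  have hinj : Function.Injective ψ.mulShift := AddChar.to_mulShift_inj_of_isPrimitive hprim
  have hsurj : Function.Surjective ψ.mulShift := by
    let _ := Fintype.ofFinite R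
    refine ((Fintype.bijective_iff_injective_and_card _).2 ⟨hinj, ?_⟩).2
    exact (AddChar.card_eq (α := R)).symm
  obtain ⟨b, rfl⟩ := hsurj χ
  have h0 : ϖ ^ l * b = 0 := by
    by_contra hne
    refine hprim hne (DFunLike.ext _ _ fun x => ?_)
    have h1 := hχ x
    rw [AddChar.mulShift_apply] at h1
    rw [AddChar.mulShift_apply, AddChar.one_apply, ← h1]
    congr 1
    ring
  obtain ⟨a, rfl⟩ := H.dvd_of_mul_eq_zero l (by omega) b h0
  refine ⟨a, fun x => ?_⟩
  rw [AddChar.mulShift_apply, show r - l = l by omega, mul_assoc]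

end Duality

section Local

variable {F : Type*} [Field F] [ValuativeRel F] [TopologicalSpace F]
  [IsNonarchimedeanLocalField F] {E : Type*} [Field E] [Algebra F E]

theorem card_quotient_maximalIdeal_pow (k : ℕ) :
    Nat.card (𝒪[F] ⧸ 𝓂[F] ^ k) = Nat.card 𝓀[F] ^ k := by
  have h := cardQuot_pow_of_prime (P := 𝓂[F]) (i := k)
    (IsDiscreteValuationRing.not_a_field 𝒪[F])
  exact h

variable (F) in
theorem finite_intMod (r : ℕ) : Finite (intMod F r) := by
  refine Nat.finite_of_card_ne_zero ?_
  rw [card_quotient_maximalIdeal_pow]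
  exact pow_ne_zero _ Nat.card_pos.ne'

theorem maximalIdeal_pow_eq {ϖ : 𝒪[F]} (hϖ : Irreducible ϖ) (k : ℕ) :
    𝓂[F] ^ k = Ideal.span {ϖ ^ k} := by
  rw [hϖ.maximalIdeal_eq, Ideal.span_singleton_pow]

theorem mk_eq_zero_iff {ϖ : 𝒪[F]} (hϖ : Irreducible ϖ) (r : ℕ) (y : 𝒪[F]) :
    (Ideal.Quotient.mk (𝓂[F] ^ r) y : intMod F r) = 0 ↔ ϖ ^ r ∣ y := by
  rw [Ideal.Quotient.eq_zero_iff_mem, maximalIdeal_pow_eq hϖ, Ideal.mem_span_singleton]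

theorem isTruncatedDVR_intMod (hp : ringChar 𝓀[F] ≠ 2) {ϖ : 𝒪[F]} (hϖ : Irreducible ϖ) (r : ℕ) :
    IsTruncatedDVR (unifMod ϖ r) r (Nat.card 𝓀[F]) where
  isUnit_or_dvd x := by
    obtain ⟨y, rfl⟩ := Ideal.Quotient.mk_surjective x
    by_cases hy : IsUnit y
    · exact Or.inl (hy.map _)
    · rw [← mem_nonunits_iff, ← IsLocalRing.mem_maximalIdeal, hϖ.maximalIdeal_eq,
        Ideal.mem_span_singleton] at hy
      exact Or.inr (map_dvd _ hy)
  pow_eq_zero := by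
    rw [← map_pow]
    exact (mk_eq_zero_iff hϖ r _).2 dvd_rfl
  dvd_of_mul_eq_zero k hk x hx := by
    obtain ⟨y, rfl⟩ := Ideal.Quotient.mk_surjective x
    rw [← map_pow, ← map_mul, mk_eq_zero_iff hϖ, ← Nat.add_sub_cancel' hk, pow_add] at hx
    rw [← map_pow]
    exact map_dvd _ ((mul_dvd_mul_iff_left (pow_ne_zero k hϖ.ne_zero)).1 hx)
  card_dvd k hk := by
    let f : 𝒪[F] →ₗ[𝒪[F]] intMod F r :=
      (Ideal.Quotient.mkₐ 𝒪[F] (𝓂[F] ^ r)).toLinearMap ∘ₗ LinearMap.mulLeft 𝒪[F] (ϖ ^ k)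
    have hf : ∀ y, f y = Ideal.Quotient.mk (𝓂[F] ^ r) (ϖ ^ k * y) := fun y => rfl
    have hker : LinearMap.ker f = 𝓂[F] ^ (r - k) := by
      ext y
      rw [LinearMap.mem_ker, hf, mk_eq_zero_iff hϖ, maximalIdeal_pow_eq hϖ,
        Ideal.mem_span_singleton]
      nth_rewrite 1 [← Nat.add_sub_cancel' hk]
      rw [pow_add]
      exact mul_dvd_mul_iff_left (pow_ne_zero k hϖ.ne_zero)
    have hrange : ∀ x : intMod F r, x ∈ LinearMap.range f ↔ unifMod ϖ r ^ k ∣ x := by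
      intro x
      constructor
      · rintro ⟨y, rfl⟩
        rw [hf, map_mul, map_pow]
        exact dvd_mul_right _ _
      · rintro ⟨y, rfl⟩
        obtain ⟨y, rfl⟩ := Ideal.Quotient.mk_surjective y
        exact ⟨y, by rw [hf, map_mul, map_pow]⟩
    rw [← card_quotient_maximalIdeal_pow (F := F) (r - k), ← hker]
    exact (Nat.card_congr (f.quotKerEquivRange.toEquiv.trans
      (Equiv.subtypeEquivRight hrange))).symm
  isUnit_two := by
    have h : IsUnit (2 : 𝒪[F]) := by
      by_contra h2
      rw [← mem_nonunits_iff, ← IsLocalRing.mem_maximalIdeal,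
        ← IsLocalRing.residue_eq_zero_iff, map_ofNat] at h2
      exact Ring.two_ne_zero hp h2
    have h2 := h.map (Ideal.Quotient.mk (𝓂[F] ^ r))
    rw [map_ofNat] at h2
    exact h2
  one_lt := Finite.one_lt_card

theorem nontrivial_intMod (r : ℕ) (hr : 0 < r) : Nontrivial (intMod F r) :=
  Ideal.Quotient.nontrivial_iff.2 fun h => Ideal.IsPrime.ne_top' (I := 𝓂[F]) (top_le_iff.1 (by
    rw [← h]; exact Ideal.pow_le_self hr.ne'))

theorem isUnit_of_mul_add_eq_one {A : Type*} [CommRing A] {ϖ y z p : A} {r : ℕ} (h0 : ϖ ^ r = 0)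
    (hp : ϖ ∣ p) (h : z * y + p = 1) : IsUnit y := by
  obtain ⟨w, rfl⟩ := hp
  have h1 : IsNilpotent (ϖ * w) := ⟨r, by rw [mul_pow, h0, zero_mul]⟩
  have h2 : IsUnit (z * y) := by
    rw [eq_sub_of_add_eq h]
    exact h1.isUnit_one_sub
  exact isUnit_of_mul_isUnit_right h2

/-- The ring `𝒪_r^E` is local with maximal ideal generated by `ϖ`, as `E / F` is unramified. -/
theorem isUnit_or_dvd_intModE {σ : E ≃ₐ[F] E} (hE : IsUnramifiedQuadratic F E σ) {ϖ : 𝒪[F]}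
    (hϖ : Irreducible ϖ) (r : ℕ) (x : intModE F E r) : IsUnit x ∨ unifModE E ϖ r ∣ x := by
  obtain ⟨y, rfl⟩ := Ideal.Quotient.mk_surjective x
  have hP : ∀ z ∈ 𝓂[F].map (algebraMap 𝒪[F] (intE F E)),
      unifModE E ϖ r ∣ (Ideal.Quotient.mk _ z : intModE F E r) := by
    intro z hz
    rw [hϖ.maximalIdeal_eq, Ideal.map_span, Set.image_singleton, Ideal.mem_span_singleton] at hz
    exact map_dvd (Ideal.Quotient.mk _) hz
  by_cases hy : y ∈ 𝓂[F].map (algebraMap 𝒪[F] (intE F E))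
  · exact Or.inr (hP y hy)
  · left
    obtain ⟨z, p, hp, hzp⟩ := hE.isMaximal.exists_inv hy
    have h0 : unifModE E ϖ r ^ r = 0 := by
      rw [← map_pow, ← map_pow, (mk_eq_zero_iff hϖ r _).2 dvd_rfl, map_zero]
    have h1 := congrArg (Ideal.Quotient.mk ((𝓂[F] ^ r).map (algebraMap 𝒪[F] (intE F E)))) hzp
    rw [map_add, map_mul, map_one] at h1
    exact isUnit_of_mul_add_eq_one h0 (hP p hp) h1

end Local

/-! ### Elements attached to a pair of characters -/

section QuadraticAlgebra

variable {R : Type*} [CommRing R] {A : Type*} [CommRing A] [Algebra R A]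

section Involution

variable {σ : A → A} (hadd : ∀ x y, σ (x + y) = σ x + σ y) (hmul : ∀ x y, σ (x * y) = σ x * σ y)
  (hσ : ∀ z, σ (σ z) = z) (hσR : ∀ a : R, σ (algebraMap R A a) = algebraMap R A a)
  (htr : ∀ z, ∃ a : R, algebraMap R A a = z + σ z) (h2 : IsUnit (2 : R))

include htr h2 in
theorem exists_algebraMap_of_fixed {z : A} (hz : σ z = z) : ∃ a : R, algebraMap R A a = z := by
  obtain ⟨d, hd⟩ := h2.exists_right_inv
  obtain ⟨a, ha⟩ := htr z
  have hdA : 2 * algebraMap R A d = 1 := by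
    rw [← map_ofNat (algebraMap R A), ← map_mul, hd, map_one]
  refine ⟨a * d, ?_⟩
  rw [map_mul, ha, hz]
  linear_combination z * hdA

include hmul hσR htr h2 in
/-- A square root `Φ` of a non-square is antisymmetric under the involution. -/
theorem involution_sqrt {p : R} (hloc : ∀ x : A, IsUnit x ∨ algebraMap R A p ∣ x)
    (hp : ¬ IsUnit (algebraMap R A p)) (hinj : Function.Injective (algebraMap R A))
    {ε : R} (hε : IsUnit ε) (hsq : ¬ IsSquare ε) {Φ : A} (hΦ : Φ ^ 2 = algebraMap R A ε) :
    σ Φ = -Φ := by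
  have hΦu : IsUnit Φ := (isUnit_pow_iff two_ne_zero).1 (by rw [hΦ]; exact hε.map _)
  have hprod : (σ Φ - Φ) * (σ Φ + Φ) = 0 := by
    have h3 : σ Φ ^ 2 = Φ ^ 2 := by rw [pow_two, ← hmul, ← pow_two, hΦ, hσR]
    linear_combination h3
  rcases hloc (σ Φ - Φ) with h | h
  · exact eq_neg_of_add_eq_zero_left (h.mul_right_eq_zero.1 hprod)
  rcases hloc (σ Φ + Φ) with h' | h'
  · exfalso
    have hfix : σ Φ = Φ := sub_eq_zero.1 (h'.mul_left_eq_zero.1 hprod)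
    obtain ⟨a, ha⟩ := exists_algebraMap_of_fixed htr h2 hfix
    refine hsq ⟨a, hinj ?_⟩
    rw [← hΦ, ← ha, map_mul, pow_two]
  · exfalso
    have h3 : algebraMap R A p ∣ algebraMap R A 2 * Φ := by
      have := dvd_sub h' h
      rwa [show σ Φ + Φ - (σ Φ - Φ) = algebraMap R A 2 * Φ by rw [map_ofNat]; ring] at this
    exact hp (isUnit_of_dvd_unit h3 ((h2.map _).mul hΦu))

include hadd hmul hσ htr h2 in
/-- The elements `1` and `Φ` generate `A` as an `R`-module. -/
theorem exists_coordinates {ε : R} (hε : IsUnit ε) {Φ : A} (hΦ : Φ ^ 2 = algebraMap R A ε)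
    (hσΦ : σ Φ = -Φ) (z : A) : ∃ x y : R, z = algebraMap R A x + algebraMap R A y * Φ := by
  obtain ⟨d, hd⟩ := h2.exists_right_inv
  obtain ⟨e, he⟩ := hε.exists_right_inv
  have hdA : 2 * algebraMap R A d = 1 := by
    rw [← map_ofNat (algebraMap R A), ← map_mul, hd, map_one]
  have heA : Φ ^ 2 * algebraMap R A e = 1 := by rw [hΦ, ← map_mul, he, map_one]
  obtain ⟨a, ha⟩ := htr z
  obtain ⟨b, hb⟩ := exists_algebraMap_of_fixed htr h2 (z := (z - σ z) * Φ) (by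
    have h3 : σ (z - σ z) = σ z - z := by
      have h4 := hadd (z - σ z) (σ z)
      rw [sub_add_cancel, hσ] at h4
      exact eq_sub_of_add_eq h4.symm
    rw [hmul, h3, hσΦ]; ring)
  refine ⟨a * d, b * e * d, ?_⟩
  rw [map_mul, map_mul, map_mul, ha, hb]
  linear_combination (-z) * hdA - (z - σ z) * algebraMap R A d * heA

end Involution

section Attached

variable {ϖ : R} {r q : ℕ} [Nontrivial R] [Finite R] (H : IsTruncatedDVR ϖ r q)
  (ν ν' : MulChar A ℂ) {ψ : AddChar R ℂ}

/-- The additive character `x ↦ ν(1 + ϖ ^ l x c) ν'(1 + ϖ ^ l x c')` of `R`. -/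
noncomputable def congruenceChar {l : ℕ} (hϖ : ϖ ^ l * ϖ ^ l = 0) (c c' : A) : AddChar R ℂ where
  toFun x := ν (1 + algebraMap R A (ϖ ^ l * x) * c) * ν' (1 + algebraMap R A (ϖ ^ l * x) * c')
  map_zero_eq_one' := by simp
  map_add_eq_mul' x y := by
    have h0 : algebraMap R A (ϖ ^ l) * algebraMap R A (ϖ ^ l) = 0 := by
      rw [← map_mul, hϖ, map_zero]
    rw [mul_mul_mul_comm, ← map_mul, ← map_mul]
    simp only [map_mul (algebraMap R A), map_add (algebraMap R A)]
    congr 2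
    · linear_combination (-(algebraMap R A x * algebraMap R A y * c ^ 2)) * h0
    · linear_combination (-(algebraMap R A x * algebraMap R A y * c' ^ 2)) * h0

omit [Nontrivial R] [Finite R] in
theorem congruenceChar_apply {l : ℕ} (hϖ : ϖ ^ l * ϖ ^ l = 0) (c c' : A) (x : R) :
    congruenceChar ν ν' hϖ c c' x
      = ν (1 + algebraMap R A (ϖ ^ l * x) * c) * ν' (1 + algebraMap R A (ϖ ^ l * x) * c') := rfl

include H in
/-- By duality, the character `1 + ϖ ^ l z ↦ ν(1 + ϖ ^ l z) ν'(1 + ϖ ^ l σ(z))` has the form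
`ψ (ϖ ^ l Tr(τ z))` with `τ = h + η Φ`; regularity says that `η` is a unit. -/
theorem exists_dual_parameter {l : ℕ} (hl : 0 < l) (hr : r = 2 * l)
    (hψ : ∃ x, ψ (ϖ ^ (r - 1) * x) ≠ 1) {ε : R} (hε : IsUnit ε) {Φ : A}
    (hreg : ∃ y : R, ν (1 + algebraMap R A (ϖ ^ (r - 1) * y) * Φ)
      * ν' (1 + algebraMap R A (ϖ ^ (r - 1) * y) * -Φ) ≠ 1) :
    ∃ h η : R, IsUnit η ∧ ∀ x y : R,
      ν (1 + algebraMap R A (ϖ ^ l) * (algebraMap R A x + algebraMap R A y * Φ))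
        * ν' (1 + algebraMap R A (ϖ ^ l) * (algebraMap R A x - algebraMap R A y * Φ))
      = ψ (ϖ ^ l * (2 * h * x + 2 * ε * η * y)) := by
  have hϖ : ϖ ^ l * ϖ ^ l = 0 := by rw [← pow_add, ← two_mul, ← hr, H.pow_eq_zero]
  have htriv : ∀ (c c' : A) (x : R), congruenceChar ν ν' hϖ c c' (ϖ ^ l * x) = 1 := by
    intro c c' x
    rw [congruenceChar_apply, ← mul_assoc, hϖ]
    simp
  obtain ⟨a, ha⟩ := exists_eq_mulShift H hl hr hψ _ (htriv 1 1)
  obtain ⟨b, hb⟩ := exists_eq_mulShift H hl hr hψ _ (htriv Φ (-Φ))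
  obtain ⟨d, hd⟩ := H.isUnit_two.exists_right_inv
  obtain ⟨e, he⟩ := hε.exists_right_inv
  have hη : 2 * ε * (d * e * b) = b := by linear_combination ε * e * b * hd + b * he
  refine ⟨d * a, d * e * b, ?_, ?_⟩
  · rw [H.isUnit_iff]
    rintro ⟨z, hz⟩
    obtain ⟨y, hy⟩ := hreg
    apply hy
    have h1 := hb (ϖ ^ (r - 1 - l) * y)
    rw [congruenceChar_apply, ← mul_assoc, ← pow_add, show l + (r - 1 - l) = r - 1 by omega] at h1
    rw [h1, ← AddChar.map_zero_eq_one ψ]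
    congr 1
    have h3 : ϖ ^ l * ϖ * ϖ ^ (r - 1 - l) = 0 := by
      rw [← pow_succ, ← pow_add, show l + 1 + (r - 1 - l) = r by omega, H.pow_eq_zero]
    rw [← hη, hz]
    linear_combination (2 * ε * z * y) * h3
  · intro x y
    have e1 : ϖ ^ l * (2 * (d * a) * x + 2 * ε * (d * e * b) * y)
        = ϖ ^ l * (a * x) + ϖ ^ l * (b * y) := by
      rw [hη]; linear_combination (ϖ ^ l * a * x) * hd
    rw [e1, AddChar.map_add_eq_mul, ← ha, ← hb, congruenceChar_apply, congruenceChar_apply,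
      mul_mul_mul_comm, ← map_mul, ← map_mul]
    have h0 : algebraMap R A (ϖ ^ l) * algebraMap R A (ϖ ^ l) = 0 := by
      rw [← map_mul, hϖ, map_zero]
    simp only [map_mul (algebraMap R A)]
    congr 2
    · linear_combination (-(algebraMap R A x * algebraMap R A y * Φ)) * h0
    · linear_combination (algebraMap R A x * algebraMap R A y * Φ) * h0

end Attached

end QuadraticAlgebra

/-! ### Transfer to the rings `𝒪_r` and `𝒪_r^E` -/

section Transfer

variable {R : Type*} [CommRing R] {A : Type*} [CommRing A] [Algebra R A]

/-- The character formula for `ν ⊠ ν'` with `β` the companion matrix of the minimal polynomial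
of `τ = h + η Φ`, where the conjugate of `τ` is `τ' = h - η Φ`. -/
theorem character_ellipticElt_of_coordinates {ϖ ε n t h η : R} {Φ τ τ' : A}
    [Nontrivial R] [Finite R] {r l q : ℕ} (H : IsTruncatedDVR ϖ r q)
    (hinj : Function.Injective (algebraMap R A))
    (hε : IsUnit ε) (hsq : ¬ IsSquare ε) (hη : IsUnit η) (hΦ : Φ ^ 2 = algebraMap R A ε)
    (hn : algebraMap R A n = τ * τ') (ht : algebraMap R A t = τ + τ')
    (hτΦ : τ = algebraMap R A h + algebraMap R A η * Φ)
    (hτΦ' : τ' = algebraMap R A h - algebraMap R A η * Φ)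
    (hτ : τ * τ = algebraMap R A t * τ - algebraMap R A n)
    (hτ' : τ' * τ' = algebraMap R A t * τ' - algebraMap R A n)
    (ν ν' : MulChar A ℂ) (ψ : AddChar R ℂ) (hψ : ∃ x, ψ (ϖ ^ (r - 1) * x) ≠ 1)
    (hϖ : ϖ ^ l * ϖ ^ l = 0)
    (hcomp : ∀ x y : R,
      ν (1 + algebraMap R A (ϖ ^ l) * (algebraMap R A x + algebraMap R A y * τ))
        * ν' (1 + algebraMap R A (ϖ ^ l) * (algebraMap R A x + algebraMap R A y * τ'))
      = ψ (ϖ ^ l * (x * t + y * (t * t - 2 * n))))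
    (hl : 0 < l) (hr : r = 2 * l) {i : ℕ} (hi : i ≤ r - 1) {α β : R}
    (hβ : IsUnit β) (hC : IsUnit (α ^ 2 - ε * β ^ 2 * ϖ ^ (2 * i))) :
    (Representation.ind (inertia n t ϖ l).subtype
      (oneDim (boxChar n t τ τ' hτ hτ' ν ν' ψ ϖ l hϖ hcomp))).character
        (ellipticElt ϖ ε i α β hC)
      = (-(q : ℂ)) ^ i * (normPairChar ν ν' Φ α (ϖ ^ i * β)
        + normPairChar ν ν' Φ α (-(ϖ ^ i * β))) := by
  obtain rfl : n = h ^ 2 - ε * η ^ 2 := hinj (by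
    rw [hn, hτΦ, hτΦ', map_sub, map_mul, map_pow, map_pow, ← hΦ]; ring)
  obtain rfl : t = 2 * h := hinj (by
    rw [ht, hτΦ, hτΦ', map_mul, map_ofNat]; ring)
  let _ := Fintype.ofFinite R
  exact character_ellipticElt hτ hτ' ν ν' ψ hϖ hcomp hτΦ hτΦ' H hε hsq hη hψ hl hr hi hβ hC

/-- As `(1 + w) (1 - w) = 1`, the regularity condition can be stated without an inverse. -/
theorem mul_inv_apply_one_add (ν ν' : MulChar A ℂ) {w : A} (hw : w * w = 0) :
    (ν * ν'⁻¹) (1 + w) = ν (1 + w) * ν' (1 - w) := by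
  rw [MulChar.mul_apply, MulChar.inv_apply]
  congr 2
  exact Ring.inverse_unit
    (⟨1 + w, 1 - w, by linear_combination -hw, by linear_combination -hw⟩ : Aˣ)

section Involution

variable {σ : A → A} {tr : A → R} {ϖ ε : R} {Φ : A} {r q l : ℕ} [Nontrivial R]
  (H : IsTruncatedDVR ϖ r q) (hadd : ∀ x y, σ (x + y) = σ x + σ y)
  (hmul : ∀ x y, σ (x * y) = σ x * σ y) (hσ : ∀ z, σ (σ z) = z)
  (hσR : ∀ a : R, σ (algebraMap R A a) = algebraMap R A a)
  (htr : ∀ z, algebraMap R A (tr z) = z + σ z)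
  (hloc : ∀ x : A, IsUnit x ∨ algebraMap R A ϖ ∣ x)
  (hinj : Function.Injective (algebraMap R A))
  (hε : IsUnit ε) (hsq : ¬ IsSquare ε) (hΦ : Φ ^ 2 = algebraMap R A ε)

include H hinj in
theorem not_isUnit_algebraMap_uniformizer : ¬ IsUnit (algebraMap R A ϖ) := by
  intro hu
  have h1 := hu.pow r
  rw [← map_pow, H.pow_eq_zero, map_zero, isUnit_zero_iff] at h1
  exact zero_ne_one (hinj (by rw [map_zero, map_one, h1]))

include H hadd hmul hσR htr hloc hinj hε hsq hΦ in
theorem involution_add_mul_sqrt (x y : R) : σ (algebraMap R A x + algebraMap R A y * Φ)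
    = algebraMap R A x - algebraMap R A y * Φ := by
  have hσΦ := involution_sqrt hmul hσR (fun z => ⟨_, htr z⟩) H.isUnit_two hloc
    (not_isUnit_algebraMap_uniformizer H hinj) hinj hε hsq hΦ
  rw [hadd, hmul, hσΦ, hσR, hσR]
  ring

include H hadd hmul hσ hσR htr hloc hinj hε hsq hΦ in
/-- Existence of an element attached to a regular pair. -/
theorem exists_attached [Finite R] (hl : 0 < l) (hr : r = 2 * l) {ψ : AddChar R ℂ}
    (hψ : ∃ x, ψ (ϖ ^ (r - 1) * x) ≠ 1) {ν ν' : MulChar A ℂ}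
    (hreg : ∃ z, σ z = -z ∧ (ν * ν'⁻¹) (1 + algebraMap R A ϖ ^ (r - 1) * z) ≠ 1) :
    ∃ τ, τ - σ τ ∉ Ideal.span {algebraMap R A ϖ} ∧ ∀ x y : R,
      ν (1 + algebraMap R A ϖ ^ l * (algebraMap _ _ x + algebraMap _ _ y * τ)) *
        ν' (1 + algebraMap R A ϖ ^ l * (algebraMap _ _ x + algebraMap _ _ y * σ τ)) =
      ψ (ϖ ^ l * tr (τ * (algebraMap _ _ x + algebraMap _ _ y * τ))) := by
  have hconj := involution_add_mul_sqrt H hadd hmul hσR htr hloc hinj hε hsq hΦ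
  have hσΦ : σ Φ = -Φ := by simpa using hconj 0 1
  have h2A : IsUnit (2 : A) := by
    have h := H.isUnit_two.map (algebraMap R A)
    rwa [map_ofNat] at h
  have hΦu : IsUnit Φ := (isUnit_pow_iff two_ne_zero).1 (by rw [hΦ]; exact hε.map _)
  obtain ⟨h, η, hη, hdual⟩ := exists_dual_parameter H ν ν' hl hr hψ hε (Φ := Φ) (by
    obtain ⟨z, hz, hne⟩ := hreg
    obtain ⟨x, y, rfl⟩ := exists_coordinates hadd hmul hσ (fun z => ⟨_, htr z⟩) H.isUnit_two
      hε hΦ hσΦ z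
    have hx : algebraMap R A x = 0 := by
      rw [hconj] at hz
      refine h2A.mul_right_eq_zero.1 ?_
      linear_combination hz
    refine ⟨y, fun h => hne ?_⟩
    have h0 : algebraMap R A ϖ ^ (r - 1) * algebraMap R A ϖ ^ (r - 1) = 0 := by
      rw [← pow_add, ← map_pow, show r - 1 + (r - 1) = r + (r - 2) by omega, pow_add,
        H.pow_eq_zero, zero_mul, map_zero]
    rw [hx, zero_add, mul_inv_apply_one_add ν ν' (by
      linear_combination (algebraMap R A y * Φ) ^ 2 * h0), ← h]
    simp only [map_mul (algebraMap R A), map_pow (algebraMap R A)]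
    congr 2 <;> ring)
  refine ⟨algebraMap _ _ h + algebraMap _ _ η * Φ, ?_, fun x y => ?_⟩
  · rw [hconj, Ideal.mem_span_singleton]
    intro hdvd
    refine not_isUnit_algebraMap_uniformizer H hinj (isUnit_of_dvd_unit hdvd ?_)
    rw [show ∀ a b : A, a + b - (a - b) = 2 * b from fun a b => by ring]
    exact h2A.mul ((hη.map _).mul hΦu)
  · have htr' : tr ((algebraMap _ _ h + algebraMap _ _ η * Φ) * (algebraMap _ _ x
        + algebraMap _ _ y * (algebraMap _ _ h + algebraMap _ _ η * Φ)))
        = 2 * h * (x + y * h) + 2 * ε * η * (y * η) := by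
      apply hinj
      rw [htr, hmul, hadd (algebraMap _ _ x), hmul, hconj, hσR, hσR]
      simp only [map_add, map_mul, map_ofNat, ← hΦ]
      ring
    rw [htr', ← hdual, hconj]
    simp only [map_mul (algebraMap R A), map_add (algebraMap R A), map_pow (algebraMap R A)]
    congr 3 <;> ring

include H hadd hmul hσ hσR htr hloc hinj hε hsq hΦ in
/-- The coordinates of an element `τ` with `τ - σ(τ)` nonzero modulo `ϖ`. -/
theorem exists_unit_coordinate (τ : A) (hτ : τ - σ τ ∉ Ideal.span {algebraMap R A ϖ}) :
    ∃ h η : R, IsUnit η ∧ τ = algebraMap R A h + algebraMap R A η * Φ ∧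
      σ τ = algebraMap R A h - algebraMap R A η * Φ := by
  have hconj := involution_add_mul_sqrt H hadd hmul hσR htr hloc hinj hε hsq hΦ
  obtain ⟨h, η, rfl⟩ := exists_coordinates hadd hmul hσ (fun z => ⟨_, htr z⟩) H.isUnit_two hε hΦ
    (by simpa using hconj 0 1) τ
  refine ⟨h, η, (H.isUnit_or_dvd η).resolve_right ?_, rfl, hconj h η⟩
  rintro ⟨z, rfl⟩
  apply hτ
  rw [Ideal.mem_span_singleton, hconj]
  exact ⟨2 * algebraMap R A z * Φ, by rw [map_mul]; ring⟩

end Involution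

theorem normPairChar_add_normPairChar (ν ν' : MulChar A ℂ) (ϖ α β : R) (Φ : A) (i : ℕ) :
    normPairChar ν ν' Φ α (ϖ ^ i * β) + normPairChar ν ν' Φ α (-(ϖ ^ i * β))
      = ν (algebraMap R A α + algebraMap R A ϖ ^ i * Φ * algebraMap R A β) *
          ν' (algebraMap R A α - algebraMap R A ϖ ^ i * Φ * algebraMap R A β) +
        ν (algebraMap R A α - algebraMap R A ϖ ^ i * Φ * algebraMap R A β) *
          ν' (algebraMap R A α + algebraMap R A ϖ ^ i * Φ * algebraMap R A β) := by
  simp only [normPairChar, map_mul (algebraMap R A), map_neg (algebraMap R A),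
    map_pow (algebraMap R A)]
  congr 3 <;> (congr 1; ring)

end Transfer

section Local

variable {F : Type*} [Field F] [ValuativeRel F] [TopologicalSpace F]
  [IsNonarchimedeanLocalField F] {E : Type*} [Field E] [Algebra F E] (σ : E ≃ₐ[F] E) (r : ℕ)

theorem sigmaMod_add (x y : intModE F E r) :
    sigmaMod σ r (x + y) = sigmaMod σ r x + sigmaMod σ r y := by
  obtain ⟨x, rfl⟩ := Ideal.Quotient.mk_surjective x
  obtain ⟨y, rfl⟩ := Ideal.Quotient.mk_surjective y
  rw [sigmaMod_mk, sigmaMod_mk, ← map_add (Ideal.Quotient.mk _), ← map_add (Ideal.Quotient.mk _),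
    sigmaMod_mk, map_add (sigmaInt σ)]

theorem sigmaMod_mul (x y : intModE F E r) :
    sigmaMod σ r (x * y) = sigmaMod σ r x * sigmaMod σ r y := by
  obtain ⟨x, rfl⟩ := Ideal.Quotient.mk_surjective x
  obtain ⟨y, rfl⟩ := Ideal.Quotient.mk_surjective y
  rw [sigmaMod_mk, sigmaMod_mk, ← map_mul (Ideal.Quotient.mk _), ← map_mul (Ideal.Quotient.mk _),
    sigmaMod_mk, map_mul (sigmaInt σ)]

end Local

end CuspidalGL2

theorem mainTheorem1 {F : Type*} [Field F] [ValuativeRel F] [TopologicalSpace F]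
    [IsNonarchimedeanLocalField F] (hp : ringChar 𝓀[F] ≠ 2)
    {E : Type*} [Field E] [Algebra F E] (σ : E ≃ₐ[F] E)
    (hE : CuspidalGL2.IsUnramifiedQuadratic F E σ)
    (ϖ : 𝒪[F]) (hϖ : Irreducible ϖ) (r l : ℕ) (hl : 0 < l) (hr : r = 2 * l)
    (ψ : AddChar (CuspidalGL2.intMod F r) ℂ) (hψ : CuspidalGL2.IsLevel ϖ r ψ)
    (ε : CuspidalGL2.intMod F r) (hε : IsUnit ε) (hεsq : ¬ IsSquare ε)
    (Φ : CuspidalGL2.intModE F E r) (hΦ : Φ ^ 2 = algebraMap _ _ ε)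
    (ν ν' : MulChar (CuspidalGL2.intModE F E r) ℂ)
    (hreg : CuspidalGL2.IsRegularPair σ ϖ r ν ν') :
    (∃ τ, CuspidalGL2.IsAttached hE ϖ r l ψ ν ν' τ) ∧
    ∀ (τ : CuspidalGL2.intModE F E r) (hτ : CuspidalGL2.IsAttached hE ϖ r l ψ ν ν' τ)
      (i : ℕ) (_ : i ≤ r - 1) (α β : CuspidalGL2.intMod F r) (_ : IsUnit β)
      (hC : IsUnit (α ^ 2 - ε * β ^ 2 * CuspidalGL2.unifMod ϖ r ^ (2 * i))),
      (CuspidalGL2.cuspidalRep hE hϖ hr ψ ν ν' τ hτ).character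
          (CuspidalGL2.ellipticElt (CuspidalGL2.unifMod ϖ r) ε i α β hC) =
        (-(Nat.card 𝓀[F] : ℂ)) ^ i *
          (ν (algebraMap _ _ α + CuspidalGL2.unifModE E ϖ r ^ i * Φ * algebraMap _ _ β) *
              ν' (algebraMap _ _ α - CuspidalGL2.unifModE E ϖ r ^ i * Φ * algebraMap _ _ β) +
            ν (algebraMap _ _ α - CuspidalGL2.unifModE E ϖ r ^ i * Φ * algebraMap _ _ β) *
              ν' (algebraMap _ _ α + CuspidalGL2.unifModE E ϖ r ^ i * Φ * algebraMap _ _ β)) := by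
  have hr0 : 0 < r := by omega
  have hnt := CuspidalGL2.nontrivial_intMod (F := F) r hr0
  have hfin := CuspidalGL2.finite_intMod F r
  have H := CuspidalGL2.isTruncatedDVR_intMod hp hϖ r
  have hinj := CuspidalGL2.algebraMap_mod_injective F E r
  have hloc := CuspidalGL2.isUnit_or_dvd_intModE hE hϖ r
  have hadd := CuspidalGL2.sigmaMod_add (F := F) (E := E) σ r
  have hmul := CuspidalGL2.sigmaMod_mul (F := F) (E := E) σ r
  have hσ := CuspidalGL2.sigmaMod_sigmaMod hE r
  have hσR := CuspidalGL2.sigmaMod_algebraMap σ r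
  have htr := CuspidalGL2.algebraMap_trMod hE r
  have key := CuspidalGL2.exists_attached (A := CuspidalGL2.intModE F E r)
    (σ := CuspidalGL2.sigmaMod σ r) (l := l) H hadd hmul hσ hσR htr hloc hinj hε hεsq hΦ hl
  have key' := CuspidalGL2.exists_unit_coordinate (A := CuspidalGL2.intModE F E r)
    (σ := CuspidalGL2.sigmaMod σ r) H hadd hmul hσ hσR htr hloc hinj hε hεsq hΦ
  refine ⟨key hr hψ hreg, ?_⟩
  intro τ hτ i hi α β hβ hC
  obtain ⟨h, η, hη, hτΦ, hτΦ'⟩ := key' τ hτ.1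
  rw [← CuspidalGL2.normPairChar_add_normPairChar]
  have key'' := CuspidalGL2.character_ellipticElt_of_coordinates (A := CuspidalGL2.intModE F E r)
    (l := l) H hinj hε hεsq hη hΦ (CuspidalGL2.algebraMap_nmMod hE r τ) (htr τ) hτΦ hτΦ'
  exact key'' _ _ ν ν' ψ hψ (CuspidalGL2.unifMod_pow_mul_pow hϖ hr) _ hl hr hi hβ hC
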